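/- Let $U\subset\mathbb R^n$ be open and connected, and let $\omega_\lambda=\omega_2-\lambda\omega_1$, $\omega_a^{ij}=g_a^{ij}(u)\,\delta'(x-y)+\Gamma^{ij}_{(a)k}(u)\,u^k_x\,\delta(x-y)$, be a semisimple bi-Hamiltonian structure of hydrodynamic type on $U$ in canonical coordinates: $g_1,g_2$ are smooth, symmetric, $\det g_1\ne 0$; the metrics $g_2-\lambda g_1$ are flat, with contravariant Christoffel symbols $\Gamma^{ij}_{(2)k}-\lambda\Gamma^{ij}_{(1)k}$; and the roots of $\det(g_2-\lambda g_1)=0$ are the coordinates $u^1,\dots,u^n$, which are pairwise distinct on $U$. Assume that $\omega_\lambda$ is exact: there is a vector field $e$ on $U$ with $\mathrm{Lie}_e\omega_1=0$ and $\mathrm{Lie}_e\omega_2=\omega_1$. Let $$\Pi_\lambda=\omega_2+\sum_{k\ge1}\epsilon^{2k}P_2^{(2k)}-\lambda\omega_1$$ be a bi-Hamiltonian structure (a Poisson bivector for every $\lambda$), where the coefficient of $\delta^{(2k+1-s)}(x-y)$ in $P_2^{(2k)}$ is a homogeneous differential polynomial of degree $s$. Assume that $P_2^{(2)}$ is in standard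 form, that is, $P_2^{(2)}=\mathrm{Lie}_{X_c}\omega_1$, where, with $f^i=g_1^{ii}$ and smooth functions $c^j=c^j(u^j)$ of one variable, $$X_c^i=\sum_{j}\Big[\big(\tfrac12\delta_{ij}\partial_xf^i+A^{ij}\big)c^ju^j_x+(2\delta_{ij}f^i-L^{ij})\,\partial_x(c^ju^j_x)\Big],$$ $$A^{ij}=\tfrac12\Big(\tfrac{f^i}{f^j}\tfrac{\partial f^j}{\partial u^i}u^j_x-\tfrac{f^j}{f^i}\tfrac{\partial f^i}{\partial u^j}u^i_x\Big),\qquad L^{ij}=\tfrac12\delta_{ij}f^i+\tfrac{(u^i-u^j)f^i}{2f^j}\tfrac{\partial f^j}{\partial u^i}.$$ Let $c_i=-\frac1{3f^i}\mathrm{Res}_{\lambda=u^i}\mathrm{Tr}\,(g_2-\lambda g_1)^{-1}A_\lambda$ be the central invariants of $\Pi_\lambda$, where $A_\lambda^{ij}$ is the coefficient of $\delta'''(x-y)$ in $P_2^{(2)}$. Then, for every integer $l\ge 0$, the central invariants $c_i$ are polynomials in $u^i$ with $$\max_{i=1,\dots,n}\deg c_i=l$$ (the zero polynomial having degree $-\infty$)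 if and only if $$\mathrm{Lie}_e^{l+1}P_2^{(2)}=0\quad\text{and}\quad \mathrm{Lie}_e^{l}P_2^{(2)}\ne0.$$ The same equivalence holds with the parameter functions $c^1,\dots,c^n$ of the standard form in place of the central invariants. -/

import Mathlib

open scoped ContDiff
open Filter (limUnder)

noncomputable section

namespace LoopSpace

/-! ## Differential functions on the formal loop space of an open set `U ⊆ ℝⁿ` -/

/-- Jets `(u, u_x, u_xx, …)` with base point in `U`: `J s i` stands for `u^i_{(s)}`. -/
abbrev Jet {n : ℕ} (U : Set (Fin n → ℝ)) : Type :=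
  {J : ℕ → Fin n → ℝ // J 0 ∈ U}

/-- Functions of the jet variables. -/
abbrev DiffFun {n : ℕ} (U : Set (Fin n → ℝ)) : Type := Jet U → ℝ

variable {n : ℕ} {U : Set (Fin n → ℝ)}

open Classical in
/-- Extension by zero to jets whose base point lies outside `U`. -/
def extend (F : DiffFun U) (J : ℕ → Fin n → ℝ) : ℝ :=
  if h : J 0 ∈ U then F ⟨J, h⟩ else 0

/-- The partial derivative `∂F/∂u^i_{(s)}`. -/
def pd (s : ℕ) (i : Fin n) (F : DiffFun U) : DiffFun U := fun J =>
  deriv (fun t : ℝ => extend F (J.1 + Pi.single s (Pi.single i t))) 0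

/-- The total derivative `∂_x F = ∑ u^i_{(s+1)} ∂F/∂u^i_{(s)}` (a finite sum for functions
of finitely many jet variables). -/
def dx (F : DiffFun U) : DiffFun U := fun J =>
  ∑ᶠ s : ℕ, ∑ i : Fin n, J.1 (s + 1) i * pd s i F J

/-- The jet coordinate `u^i_{(s)}`. -/
def jet (s : ℕ) (i : Fin n) : DiffFun U := fun J => J.1 s i

/-- A function of `u` alone, as a differential function. -/
def lift (f : (Fin n → ℝ) → ℝ) : DiffFun U := fun J => f (J.1 0)

/-- The constant jet `(u, 0, 0, …)`. -/
def constJet (u : U) : Jet U := ⟨fun s => if s = 0 then u.1 else 0, by simp⟩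

/-- `F` is given by the polynomial `p` in the variables `u^i_{(s+1)}` (indexed by `(s, i)`),
whose coefficients are smooth functions of `u ∈ U`. -/
def IsGivenBy (F : DiffFun U)
    (p : MvPolynomial (ℕ × Fin n) ((Fin n → ℝ) → ℝ)) : Prop :=
  (∀ m, ContDiffOn ℝ ∞ (p.coeff m) U) ∧
  ∀ J : Jet U, F J =
    MvPolynomial.eval₂ (Pi.evalRingHom (fun _ : Fin n → ℝ => ℝ) (J.1 0))
      (fun v => J.1 (v.1 + 1) v.2) p

/-- Differential polynomials. -/
def IsDiffPoly (F : DiffFun U) : Prop := ∃ p, IsGivenBy F p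

/-- Homogeneous differential polynomials of degree `d`, where `deg u_{(s)} = s`. -/
def IsHomDiffPoly (d : ℕ) (F : DiffFun U) : Prop :=
  ∃ p, IsGivenBy F p ∧ p.IsWeightedHomogeneous (fun v : ℕ × Fin n => v.1 + 1) d

/-! ## Local vector fields and bivectors -/

/-- A local vector field, given by its components `X^i`. -/
abbrev VField {n : ℕ} (U : Set (Fin n → ℝ)) : Type := Fin n → DiffFun U

/-- The action on functions of `∑ ∂_x^s X^i ∂/∂u^i_{(s)}`. -/
def prolong (X : VField U) (F : DiffFun U) : DiffFun U := fun J =>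
  ∑ᶠ s : ℕ, ∑ i : Fin n, (dx^[s] (X i)) J * pd s i F J

/-- The scalar differential operator `∑_k A_k ∂_x^k`, equivalently the distribution
`∑_k A_k δ^{(k)}(x - y)`; `A k` is the coefficient of `δ^{(k)}`. -/
abbrev DiffOp {n : ℕ} (U : Set (Fin n → ℝ)) : Type := ℕ →₀ DiffFun U

/-- Composition, from `∂^a ∘ B = ∑_r (a choose r) (∂_x^r B) ∂^(a-r)`. -/
def comp (P Q : DiffOp U) : DiffOp U :=
  P.sum fun a A => Q.sum fun b B =>
    ∑ r ∈ Finset.range (a + 1),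
      Finsupp.single (a + b - r) (((a.choose r : ℕ) : DiffFun U) * A * dx^[r] B)

/-- The formal adjoint: `(A ∂^a)^* = (-∂)^a ∘ A`. -/
def adjoint (P : DiffOp U) : DiffOp U :=
  P.sum fun a A => ∑ r ∈ Finset.range (a + 1),
    Finsupp.single (a - r) ((-1) ^ a * ((a.choose r : ℕ) : DiffFun U) * dx^[r] A)

/-- The action of a differential operator on a function. -/
def apply (P : DiffOp U) (F : DiffFun U) : DiffFun U :=
  P.sum fun a A => A * dx^[a] F

/-- The derivative of the coefficients of an operator along a vector field. -/
def prolongOp (X : VField U) (P : DiffOp U) : DiffOp U :=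
  P.sum fun a A => Finsupp.single a (prolong X A)

/-- The Frechet derivative `∑_s ∂F/∂u^k_{(s)} ∂_x^s`. -/
def frechet (F : DiffFun U) (k : Fin n) : DiffOp U :=
  ∑ᶠ s : ℕ, Finsupp.single s (pd s k F)

/-- Local bivectors `P^{ij} = ∑_k P^{ij}_k δ^{(k)}(x - y)`. -/
abbrev Bivector {n : ℕ} (U : Set (Fin n → ℝ)) : Type := Fin n → Fin n → DiffOp U

/-- The Lie derivative of a bivector:
`(Lie_X P)^{ij} = ∑ ∂_x^s X^k ∂P^{ij}/∂u^k_{(s)}(x) - ∑ ∂X^i/∂u^k_{(s)}(x) ∂_x^s P^{kj}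
  - ∑ ∂X^j/∂u^k_{(s)}(y) ∂_y^s P^{ik}`; in terms of operators the last sum is
`∑_k P^{ik} ∘ (frechet X^j k)^*`. -/
def lieDeriv (X : VField U) (P : Bivector U) : Bivector U := fun i j =>
  prolongOp X (P i j) - ∑ k, comp (frechet (X i) k) (P k j)
    - ∑ k, comp (P i k) (adjoint (frechet (X j) k))

/-- Skew-symmetric bivectors in which the coefficient of `δ^{(k+1-l)}` is a homogeneous
differential polynomial of degree `l`, for `0 ≤ l ≤ k + 1`: the terms of order `ε^k`. -/
def IsLocalBivector (k : ℕ) (P : Bivector U) : Prop :=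
  (∀ i j, P i j = - adjoint (P j i)) ∧
  (∀ i j s, s ≤ k + 1 → IsHomDiffPoly (k + 1 - s) (P i j s)) ∧
  (∀ i j s, k + 1 < s → P i j s = 0)

/-- The image `P η` of a covector. -/
def applyCov (P : Bivector U) (η : Fin n → DiffFun U) : VField U := fun i =>
  ∑ j, apply (P i j) (η j)

/-- The density `ξ · (prolong_{P η} Q) ζ`. -/
def jacTerm (P Q : Bivector U) (ξ η ζ : Fin n → DiffFun U) : DiffFun U :=
  ∑ i, ∑ j, ξ i * apply (prolongOp (applyCov P η) (Q i j)) (ζ j)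

/-- The Jacobi identity for the formal series `∑_m ε^m P_m` of skew-symmetric bivectors:
at each order in `ε` the cyclic sum of `ξ · (prolong_{P η} P) ζ` is a total derivative. -/
def IsPoisson (P : ℕ → Bivector U) : Prop :=
  ∀ ξ η ζ : Fin n → DiffFun U,
    (∀ i, IsDiffPoly (ξ i)) → (∀ i, IsDiffPoly (η i)) → (∀ i, IsDiffPoly (ζ i)) →
    ∀ m : ℕ, ∃ h : DiffFun U, IsDiffPoly h ∧
      ∑ ab ∈ Finset.HasAntidiagonal.antidiagonal m,
        (jacTerm (P ab.1) (P ab.2) ξ η ζ + jacTerm (P ab.1) (P ab.2) η ζ ξ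
          + jacTerm (P ab.1) (P ab.2) ζ ξ η) = dx h

/-! ## Pencils of hydrodynamic type -/

/-- The partial derivative `∂f/∂u^k`. -/
def partialDeriv (k : Fin n) (f : (Fin n → ℝ) → ℝ) (u : Fin n → ℝ) : ℝ :=
  fderiv ℝ f u (Pi.single k 1)

/-- The Christoffel symbols `Γ^j_{lk}` of the Levi-Civita connection of the metric whose
contravariant components are `g`. -/
def christoffel (g : (Fin n → ℝ) → Matrix (Fin n) (Fin n) ℝ) (j l k : Fin n)
    (u : Fin n → ℝ) : ℝ :=
  1 / 2 * ∑ m, g u j m *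
    (partialDeriv l (fun v => (g v)⁻¹ m k) u + partialDeriv k (fun v => (g v)⁻¹ m l) u
      - partialDeriv m (fun v => (g v)⁻¹ l k) u)

/-- The contravariant Christoffel symbols `Γ^{ij}_k = - g^{il} Γ^j_{lk}`. -/
def contraChristoffel (g : (Fin n → ℝ) → Matrix (Fin n) (Fin n) ℝ) (i j k : Fin n)
    (u : Fin n → ℝ) : ℝ :=
  - ∑ l, g u i l * christoffel g j l k u

/-- The Riemann tensor `R^i_{jkl}`. -/
def riemann (g : (Fin n → ℝ) → Matrix (Fin n) (Fin n) ℝ) (i j k l : Fin n)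
    (u : Fin n → ℝ) : ℝ :=
  partialDeriv k (christoffel g i l j) u - partialDeriv l (christoffel g i k j) u
    + ∑ m, (christoffel g i k m u * christoffel g m l j u
      - christoffel g i l m u * christoffel g m k j u)

/-- The coefficients of two bivectors `g^{ij} δ' + Γ^{ij}_k u^k_x δ`;
`Γ₁ i j k` stands for `Γ^{ij}_{(1)k}`. -/
structure HydroPencil (n : ℕ) where
  g₁ : (Fin n → ℝ) → Matrix (Fin n) (Fin n) ℝ
  g₂ : (Fin n → ℝ) → Matrix (Fin n) (Fin n) ℝ
  Γ₁ : Fin n → Fin n → Fin n → (Fin n → ℝ) → ℝ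
  Γ₂ : Fin n → Fin n → Fin n → (Fin n → ℝ) → ℝ

/-- The bivector `g^{ij} δ'(x - y) + Γ^{ij}_k u^k_x δ(x - y)`. -/
def hydroBivector (g : (Fin n → ℝ) → Matrix (Fin n) (Fin n) ℝ)
    (Γ : Fin n → Fin n → Fin n → (Fin n → ℝ) → ℝ) : Bivector U := fun i j =>
  Finsupp.single 1 (lift fun u => g u i j) +
    Finsupp.single 0 (∑ k, lift (Γ i j k) * jet 1 k)

/-- The metric pencil `g_μ = g₂ - μ g₁`. -/
def HydroPencil.metric (H : HydroPencil n) (μ : ℝ) (u : Fin n → ℝ) :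
    Matrix (Fin n) (Fin n) ℝ :=
  H.g₂ u - μ • H.g₁ u

/-- Semisimple bi-Hamiltonian structures of hydrodynamic type on `U`, written in canonical
coordinates: the two metrics form a flat pencil, `Γ₁` and `Γ₂` are its contravariant
Christoffel symbols, and the roots of `det (g₂ - μ g₁) = 0` are the coordinates
`u^1, …, u^n`, which are pairwise distinct. -/
structure HydroPencil.IsSemisimple (H : HydroPencil n) (U : Set (Fin n → ℝ)) : Prop where
  smooth_g₁ : ∀ i j, ContDiffOn ℝ ∞ (fun u => H.g₁ u i j) U
  smooth_g₂ : ∀ i j, ContDiffOn ℝ ∞ (fun u => H.g₂ u i j) U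
  smooth_Γ₁ : ∀ i j k, ContDiffOn ℝ ∞ (H.Γ₁ i j k) U
  smooth_Γ₂ : ∀ i j k, ContDiffOn ℝ ∞ (H.Γ₂ i j k) U
  symm_g₁ : ∀ u ∈ U, (H.g₁ u).IsSymm
  symm_g₂ : ∀ u ∈ U, (H.g₂ u).IsSymm
  det_ne_zero : ∀ u ∈ U, (H.g₁ u).det ≠ 0
  christoffel_g₁ : ∀ u ∈ U, ∀ i j k, H.Γ₁ i j k u = contraChristoffel H.g₁ i j k u
  flat_g₁ : ∀ u ∈ U, ∀ i j k l, riemann H.g₁ i j k l u = 0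
  christoffel_pencil : ∀ μ : ℝ, ∀ u ∈ U, (H.metric μ u).det ≠ 0 → ∀ i j k,
    H.Γ₂ i j k u - μ * H.Γ₁ i j k u = contraChristoffel (H.metric μ) i j k u
  flat_pencil : ∀ μ : ℝ, ∀ u ∈ U, (H.metric μ u).det ≠ 0 → ∀ i j k l,
    riemann (H.metric μ) i j k l u = 0
  canonical : ∀ u ∈ U, ∀ μ : ℝ, (H.metric μ u).det = (H.g₁ u).det * ∏ i, (u i - μ)
  distinct : ∀ u ∈ U, Function.Injective u

/-- The bivector `ω₁`. -/
def HydroPencil.ω₁ (H : HydroPencil n) : Bivector U := hydroBivector H.g₁ H.Γ₁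

/-- The bivector `ω₂`. -/
def HydroPencil.ω₂ (H : HydroPencil n) : Bivector U := hydroBivector H.g₂ H.Γ₂

/-- A vector field on `U`, as a vector field on the loop space. -/
def liftVec (e : (Fin n → ℝ) → Fin n → ℝ) : VField U := fun i => lift fun u => e u i

/-- `e` is a vector field on `U` that makes the pencil exact:
`Lie_e ω₁ = 0` and `Lie_e ω₂ = ω₁`. -/
structure HydroPencil.IsExactFor (H : HydroPencil n) (U : Set (Fin n → ℝ))
    (e : (Fin n → ℝ) → Fin n → ℝ) : Prop where
  smooth : ∀ i, ContDiffOn ℝ ∞ (fun u => e u i) U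
  lie_ω₁ : lieDeriv (U := U) (liftVec e) H.ω₁ = 0
  lie_ω₂ : lieDeriv (U := U) (liftVec e) H.ω₂ = H.ω₁

/-! ## Deformed pencils, central invariants, standard form -/

/-- A formal pencil `∑_k ε^k P₂ k - μ ∑_k ε^k P₁ k`. -/
structure Pencil {n : ℕ} (U : Set (Fin n → ℝ)) where
  P₁ : ℕ → Bivector U
  P₂ : ℕ → Bivector U

/-- The coefficient of `ε^k` in the pencil at the parameter `μ`. -/
def Pencil.term (Q : Pencil U) (μ : ℝ) (k : ℕ) : Bivector U := fun i j =>
  Q.P₂ k i j - μ • Q.P₁ k i j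

/-- Bi-Hamiltonian structures: `P₂ - μ P₁` is a Poisson bivector for every `μ`. -/
structure Pencil.IsBiHamiltonian (Q : Pencil U) : Prop where
  local₁ : ∀ k, IsLocalBivector k (Q.P₁ k)
  local₂ : ∀ k, IsLocalBivector k (Q.P₂ k)
  poisson : ∀ μ : ℝ, IsPoisson (Q.term μ)

/-- The pencil has the form `ω₂ + ∑_{k ≥ 1} ε^{2k} P₂^{(2k)} - μ ω₁`. -/
structure Pencil.IsReduced (Q : Pencil U) (H : HydroPencil n) : Prop where
  limit₁ : Q.P₁ 0 = H.ω₁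
  limit₂ : Q.P₂ 0 = H.ω₂
  undeformed₁ : ∀ k, 1 ≤ k → Q.P₁ k = 0
  even₂ : ∀ k, Odd k → Q.P₂ k = 0

/-- The coefficient of the highest derivative `δ^{(k+1)}` at order `ε^k`; it has degree zero,
so it is a function of `u`. -/
def Pencil.leading (Q : Pencil U) (μ : ℝ) (k : ℕ) (u : U) : Matrix (Fin n) (Fin n) ℝ :=
  Matrix.of fun i j => Q.term μ k i j (k + 1) (constJet u)

/-- The tensor `A_μ^{ij} = A_{(μ)2,0}^{ij} + (g_μ^{-1})_{lk} A_{(μ)1,0}^{li} A_{(μ)1,0}^{kj}`. -/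
def Pencil.tensorA (Q : Pencil U) (H : HydroPencil n) (μ : ℝ) (u : U) :
    Matrix (Fin n) (Fin n) ℝ :=
  Q.leading μ 2 u + (Q.leading μ 1 u).transpose * (H.metric μ u)⁻¹ * Q.leading μ 1 u

/-- The central invariants `c_i = - (1 / (3 f^i)) Res_{μ = u^i} Tr (g_μ^{-1} A_μ)`, where
`f^i = g₁^{ii}`. The pole is at most simple, since `A_{(μ)1,0}` is skew-symmetric, so the
residue is the limit of `(μ - u^i) Tr (g_μ^{-1} A_μ)`. -/
def Pencil.centralInvariant (Q : Pencil U) (H : HydroPencil n) (u : U) (i : Fin n) : ℝ :=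
  - (1 / (3 * H.g₁ u i i)) *
    limUnder (nhdsWithin (u.1 i) {u.1 i}ᶜ)
      (fun μ : ℝ => (μ - u.1 i) * ((H.metric μ u)⁻¹ * Q.tensorA H μ u).trace)

/-- The function `f^i = g₁^{ii}`. -/
def HydroPencil.f (H : HydroPencil n) (i : Fin n) : DiffFun U := lift fun u => H.g₁ u i i

/-- `A^{ij} = (1/2) ((f^i/f^j) (∂f^j/∂u^i) u^j_x - (f^j/f^i) (∂f^i/∂u^j) u^i_x)`. -/
def HydroPencil.coeffA (H : HydroPencil n) (i j : Fin n) : DiffFun U := fun J =>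
  1 / 2 * (H.f i J / H.f j J * pd 0 i (H.f j) J * jet 1 j J
    - H.f j J / H.f i J * pd 0 j (H.f i) J * jet 1 i J)

/-- `L^{ij} = (1/2) δ_{ij} f^i + ((u^i - u^j) f^i / (2 f^j)) ∂f^j/∂u^i`. -/
def HydroPencil.coeffL (H : HydroPencil n) (i j : Fin n) : DiffFun U := fun J =>
  1 / 2 * (if i = j then H.f i J else 0)
    + (jet 0 i J - jet 0 j J) * H.f i J / (2 * H.f j J) * pd 0 i (H.f j) J

/-- The vector field `X_c` with components
`X^i = ∑_j ((1/2) δ_{ij} ∂_x f^i + A^{ij}) c^j u^j_x + (2 δ_{ij} f^i - L^{ij}) ∂_x (c^j u^j_x)`,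
where `c^j` is a function of `u^j`. -/
def HydroPencil.fieldX (H : HydroPencil n) (c : Fin n → ℝ → ℝ) : VField U := fun i =>
  ∑ j, fun J : Jet U =>
    (1 / 2 * (if i = j then dx (H.f i) J else 0) + H.coeffA i j J)
        * (c j (J.1 0 j) * J.1 1 j)
      + (2 * (if i = j then H.f i J else 0) - H.coeffL i j J)
        * dx (fun K : Jet U => c j (K.1 0 j) * K.1 1 j) J

/-- The term of order `ε²` is in standard form with functional parameters `c^j(u^j)`:
it equals `Lie_{X_c} ω₁`. -/
structure Pencil.IsStandardForm (Q : Pencil U) (H : HydroPencil n) (c : Fin n → ℝ → ℝ) :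
    Prop where
  smooth : ∀ i, ContDiffOn ℝ ∞ (c i) ((fun u : Fin n → ℝ => u i) '' U)
  eq_lie : Q.P₂ 2 = lieDeriv (H.fieldX c) H.ω₁

/-- On `U` each `c_i` is a polynomial in `u^i`, and the maximal degree of these polynomials
is `l` (the zero polynomial has degree `⊥`). -/
def HasMaxDegree (c : U → Fin n → ℝ) (l : ℕ) : Prop :=
  ∃ p : Fin n → Polynomial ℝ, (∀ u : U, ∀ i, c u i = (p i).eval (u.1 i)) ∧
    (Finset.univ.sup fun i => (p i).degree) = (l : WithBot ℕ)

end LoopSpace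

end

noncomputable section

namespace LoopSpace

open Topology

variable {n : ℕ} {U : Set (Fin n → ℝ)}

/-! ### Smooth differential functions of finite order -/

/-! The argument reduces the iterated Lie derivative along `e` to the ordinary derivatives of the
parameters `c^j`. In canonical coordinates the pencil is diagonal, `g₁ = diag (f^i)` and `g₂ = diag
(u^i f^i)`. With `G = g₂ - μ g₁` at `μ = u^i`, compatibility of the connection with the metric and
vanishing of the torsion give `G · d (det G) = 0`; since `u^i` is a simple root, `d (det G)` is a
nonzero multiple of `du^i`, so the `i`-th column of `G` is zero (`metric_col_eq_zero`). Comparing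
the `δ'` coefficients of `Lie_e ω₁ = 0` and `Lie_e ω₂ = ω₁` then forces `e = ∑ ∂/∂u^k`
(`IsExactFor.eq_one`). Because the components of `e` are constant, `Lie_e` simply differentiates
every coefficient along the diagonal (`lieDeriv_liftVec_of_eq_one`). The functions `f^i` and the
differences `u^i - u^j` are invariant under diagonal translations, hence so are all coefficients of
`X_c` other than the `c^j`, and `X_c` is linear in `c`. Thus `[e, X_c] = X_{c'}`, and `Lie_e^m
P₂^{(2)} = Lie_{X_{c^{(m)}}} ω₁` (`iterate_diagDerivBi`). The diagonal `δ'''` coefficient of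
`Lie_{X_c} ω₁` is `-3 (f^i)² c^i` (`lieDeriv_fieldX_coeff_three`), so `Lie_e^m P₂^{(2)}` vanishes
exactly when every `m`-th derivative of `c^i` vanishes on the projection of `U`. These projections
are open and connected, so this says that each `c^i` is a polynomial of degree less than `m`
(`hasMaxDegree_param_iff`). The same coefficient shows that the central invariants are `-c^i`
(`centralInvariant_eq`), with the same degrees. -/

/-- `F` depends only on the jet variables of order at most `N`. -/
def HasOrder (N : ℕ) (F : DiffFun U) : Prop :=
  ∀ J J' : Jet U, (∀ s ≤ N, J.1 s = J'.1 s) → F J = F J'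

/-- `F` is of finite order and smooth along every smooth family of jets. -/
def IsSmooth (F : DiffFun U) : Prop :=
  (∃ N, HasOrder N F) ∧
  ∀ (E : Type) [NormedAddCommGroup E] [NormedSpace ℝ E] (φ : E → ℕ → Fin n → ℝ),
    (∀ s i, ContDiff ℝ ∞ fun x => φ x s i) → ∀ x, φ x 0 ∈ U →
      ContDiffAt ℝ ∞ (fun y => extend F (φ y)) x

lemma extend_coe (F : DiffFun U) (J : Jet U) : extend F J.1 = F J := by
  simp [extend, J.2]

lemma extend_of_mem (F : DiffFun U) {J : ℕ → Fin n → ℝ} (h : J 0 ∈ U) :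
    extend F J = F ⟨J, h⟩ := by
  simp [extend, h]

lemma extend_add (F G : DiffFun U) (J : ℕ → Fin n → ℝ) :
    extend (F + G) J = extend F J + extend G J := by
  by_cases h : J 0 ∈ U <;> simp [extend, h]

lemma extend_mul (F G : DiffFun U) (J : ℕ → Fin n → ℝ) :
    extend (F * G) J = extend F J * extend G J := by
  by_cases h : J 0 ∈ U <;> simp [extend, h]

lemma extend_inv (F : DiffFun U) (J : ℕ → Fin n → ℝ) :
    extend F⁻¹ J = (extend F J)⁻¹ := by
  by_cases h : J 0 ∈ U <;> simp [extend, h]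

/-- The jet `J` moved by `t` in the direction of `u^i_{(s)}`. -/
def shift (J : ℕ → Fin n → ℝ) (s : ℕ) (i : Fin n) (t : ℝ) : ℕ → Fin n → ℝ :=
  J + Pi.single s (Pi.single i t)

lemma shift_apply (J : ℕ → Fin n → ℝ) (s r : ℕ) (i k : Fin n) (t : ℝ) :
    shift J s i t r k = J r k + if r = s ∧ k = i then t else 0 := by
  by_cases h : r = s
  · subst h
    by_cases h' : k = i
    · subst h'; simp [shift]
    · simp [shift, h']
  · simp [shift, h]

@[simp] lemma shift_zero (J : ℕ → Fin n → ℝ) (s : ℕ) (i : Fin n) : shift J s i 0 = J := by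
  simp [shift]

lemma pd_def (s : ℕ) (i : Fin n) (F : DiffFun U) (J : Jet U) :
    pd s i F J = deriv (fun t => extend F (shift J.1 s i t)) 0 := rfl

section Family

variable {E : Type} [NormedAddCommGroup E] [NormedSpace ℝ E]

lemma eventually_mem_base (hU : IsOpen U) {φ : E → ℕ → Fin n → ℝ}
    (hφ : ∀ s i, ContDiff ℝ ∞ fun x => φ x s i) {x : E} (hx : φ x 0 ∈ U) :
    ∀ᶠ y in 𝓝 x, φ y 0 ∈ U := by
  have hc : Continuous fun y => φ y 0 := continuous_pi fun i => (hφ 0 i).continuous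
  exact hc.continuousAt.eventually (hU.mem_nhds hx)

lemma contDiff_shift {φ : E → ℕ → Fin n → ℝ} (hφ : ∀ s i, ContDiff ℝ ∞ fun x => φ x s i)
    {τ : E → ℝ} (hτ : ContDiff ℝ ∞ τ) (s : ℕ) (i : Fin n) (r : ℕ) (k : Fin n) :
    ContDiff ℝ ∞ fun x => shift (φ x) s i (τ x) r k := by
  simp only [shift_apply]
  by_cases h : r = s ∧ k = i
  · simpa only [h, and_self, if_true] using (hφ s i).add hτ
  · simpa [h] using hφ r k

end Family

lemma eventually_shift_mem (hU : IsOpen U) (J : Jet U) (s : ℕ) (i : Fin n) :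
    ∀ᶠ t : ℝ in 𝓝 0, shift J.1 s i t 0 ∈ U := by
  refine eventually_mem_base hU (contDiff_shift (φ := fun _ : ℝ => J.1)
    (fun _ _ => contDiff_const) contDiff_id s i) ?_
  simpa using J.2

/-- Only the values on jets near `J` enter the partial derivative. -/
lemma pd_eq_deriv (hU : IsOpen U) (s : ℕ) (i : Fin n) (F : DiffFun U) (J : Jet U) (φ : ℝ → ℝ)
    (h : ∀ (t : ℝ) (ht : shift J.1 s i t 0 ∈ U), F ⟨shift J.1 s i t, ht⟩ = φ t) :
    pd s i F J = deriv φ 0 := by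
  rw [pd_def]
  apply Filter.EventuallyEq.deriv_eq
  filter_upwards [eventually_shift_mem hU J s i] with t ht
  rw [extend_of_mem F ht, h t ht]

lemma HasOrder.mono {N M : ℕ} {F : DiffFun U} (h : HasOrder N F) (hNM : N ≤ M) :
    HasOrder M F := fun J J' hJ => h J J' fun s hs => hJ s (hs.trans hNM)

lemma HasOrder.comp₂ {N : ℕ} {F G : DiffFun U} (hF : HasOrder N F) (hG : HasOrder N G)
    (op : ℝ → ℝ → ℝ) : HasOrder N fun J => op (F J) (G J) := fun J J' hJ => by
  simp only [hF J J' hJ, hG J J' hJ]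

lemma HasOrder.sum {N : ℕ} {ι : Type*} {T : Finset ι} {F : ι → DiffFun U}
    (h : ∀ a ∈ T, HasOrder N (F a)) : HasOrder N (∑ a ∈ T, F a) := fun J J' hJ => by
  simp only [Finset.sum_apply]
  exact Finset.sum_congr rfl fun a ha => h a ha J J' hJ

lemma HasOrder.pd_eq_zero (hU : IsOpen U) {N : ℕ} {F : DiffFun U} (h : HasOrder N F) {s : ℕ}
    (hs : N < s) (i : Fin n) : pd s i F = 0 := by
  funext J
  rw [pd_eq_deriv hU s i F J (fun _ => F J)]
  · simp
  · intro t ht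
    apply h
    intro r hr
    funext k
    change shift J.1 s i t r k = J.1 r k
    rw [shift_apply, if_neg (by omega), add_zero]

lemma HasOrder.pd {N : ℕ} {F : DiffFun U} (h : HasOrder N F) (s : ℕ) (i : Fin n) :
    HasOrder N (pd s i F) := fun J J' hJ => by
  rw [pd_def, pd_def]
  congr 1
  funext t
  have e : ∀ r ≤ N, shift J.1 s i t r = shift J'.1 s i t r := fun r hr => by
    simp [shift, hJ r hr]
  by_cases hm : shift J.1 s i t 0 ∈ U
  · have hm' : shift J'.1 s i t 0 ∈ U := by rwa [← e 0 (Nat.zero_le _)]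
    rw [extend_of_mem F hm, extend_of_mem F hm']
    exact h _ _ e
  · have hm' : shift J'.1 s i t 0 ∉ U := by rwa [← e 0 (Nat.zero_le _)]
    simp [extend, hm, hm']

/-- `finsum` returns 0 on infinite support, so it is usable only after finite order bounds the
support; the fixed range also allows termwise differentiation. -/
lemma HasOrder.prolong_eq (hU : IsOpen U) {N : ℕ} {F : DiffFun U} (h : HasOrder N F)
    (X : VField U) :
    prolong X F = ∑ s ∈ Finset.range (N + 1), ∑ i, dx^[s] (X i) * LoopSpace.pd s i F := by
  funext J
  simp only [prolong, Finset.sum_apply, Pi.mul_apply]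
  refine finsum_eq_sum_of_support_subset _ fun s hs => ?_
  by_contra hN
  simp only [Finset.coe_range, Set.mem_Iio, not_lt] at hN
  exact hs (by simp [h.pd_eq_zero hU (show N < s by omega)])

lemma HasOrder.dx_eq (hU : IsOpen U) {N : ℕ} {F : DiffFun U} (h : HasOrder N F) :
    dx F = ∑ s ∈ Finset.range (N + 1), ∑ i, jet (s + 1) i * LoopSpace.pd s i F := by
  funext J
  simp only [dx, Finset.sum_apply, Pi.mul_apply, jet]
  refine finsum_eq_sum_of_support_subset _ fun s hs => ?_
  by_contra hN
  simp only [Finset.coe_range, Set.mem_Iio, not_lt] at hN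
  exact hs (by simp [h.pd_eq_zero hU (show N < s by omega)])

lemma hasOrder_jet (s : ℕ) (i : Fin n) : HasOrder (U := U) s (jet s i) := fun J J' hJ => by
  simp [jet, hJ s le_rfl]

lemma HasOrder.dx (hU : IsOpen U) {N : ℕ} {F : DiffFun U} (h : HasOrder N F) :
    HasOrder (N + 1) (dx F) := by
  rw [h.dx_eq hU]
  refine HasOrder.sum fun s hs => HasOrder.sum fun i _ => ?_
  have hs' := Finset.mem_range.1 hs
  exact ((hasOrder_jet (s + 1) i).mono (by omega)).comp₂ ((h.pd s i).mono (by omega)) (· * ·)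

/-! ### The algebra of smooth differential functions -/

lemma IsSmooth.add {F G : DiffFun U} (hF : IsSmooth F) (hG : IsSmooth G) :
    IsSmooth (F + G) := by
  obtain ⟨⟨N, hN⟩, hF⟩ := hF
  obtain ⟨⟨M, hM⟩, hG⟩ := hG
  refine ⟨⟨max N M, (hN.mono (le_max_left _ _)).comp₂ (hM.mono (le_max_right _ _)) (· + ·)⟩, ?_⟩
  intro E _ _ φ hφ x hx
  simp only [extend_add]
  exact (hF E φ hφ x hx).add (hG E φ hφ x hx)

lemma IsSmooth.mul {F G : DiffFun U} (hF : IsSmooth F) (hG : IsSmooth G) :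
    IsSmooth (F * G) := by
  obtain ⟨⟨N, hN⟩, hF⟩ := hF
  obtain ⟨⟨M, hM⟩, hG⟩ := hG
  refine ⟨⟨max N M, (hN.mono (le_max_left _ _)).comp₂ (hM.mono (le_max_right _ _)) (· * ·)⟩, ?_⟩
  intro E _ _ φ hφ x hx
  simp only [extend_mul]
  exact (hF E φ hφ x hx).mul (hG E φ hφ x hx)

lemma IsSmooth.inv {F : DiffFun U} (hF : IsSmooth F) (h0 : ∀ J, F J ≠ 0) :
    IsSmooth F⁻¹ := by
  obtain ⟨⟨N, hN⟩, hF⟩ := hF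
  refine ⟨⟨N, hN.comp₂ hN fun a _ => a⁻¹⟩, ?_⟩
  intro E _ _ φ hφ x hx
  simp only [extend_inv]
  refine (hF E φ hφ x hx).inv ?_
  rw [extend_of_mem F hx]
  exact h0 _

/-- As `U` is open, a family that meets `U` at `x` stays there nearby, so the extension by zero is
never seen. -/
lemma isSmooth_of_local (hU : IsOpen U) {N : ℕ} {F : DiffFun U} (hN : HasOrder N F)
    (h : ∀ (E : Type) [NormedAddCommGroup E] [NormedSpace ℝ E] (φ : E → ℕ → Fin n → ℝ),
      (∀ s i, ContDiff ℝ ∞ fun x => φ x s i) → ∀ x, φ x 0 ∈ U → ∃ g : E → ℝ,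
        ContDiffAt ℝ ∞ g x ∧ ∀ (y : E) (hy : φ y 0 ∈ U), F ⟨φ y, hy⟩ = g y) : IsSmooth F := by
  refine ⟨⟨N, hN⟩, ?_⟩
  intro E _ _ φ hφ x hx
  obtain ⟨g, hg, hgF⟩ := h E φ hφ x hx
  refine hg.congr_of_eventuallyEq ?_
  filter_upwards [eventually_mem_base hU hφ hx] with y hy
  rw [extend_of_mem F hy, hgF]

lemma isSmooth_const (hU : IsOpen U) (a : ℝ) : IsSmooth (U := U) fun _ => a :=
  isSmooth_of_local hU (N := 0) (fun _ _ _ => rfl)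
    fun _ _ _ _ _ _ _ => ⟨fun _ => a, contDiffAt_const, fun _ _ => rfl⟩

lemma isSmooth_jet (hU : IsOpen U) (s : ℕ) (i : Fin n) : IsSmooth (U := U) (jet s i) :=
  isSmooth_of_local hU (hasOrder_jet s i)
    fun _ _ _ φ hφ _ _ => ⟨fun y => φ y s i, (hφ s i).contDiffAt, fun _ _ => rfl⟩

lemma isSmooth_lift (hU : IsOpen U) {f : (Fin n → ℝ) → ℝ} (hf : ContDiffOn ℝ ∞ f U) :
    IsSmooth (U := U) (lift f) := by
  refine isSmooth_of_local hU (N := 0) (fun J J' h => by simp [lift, h 0 le_rfl]) ?_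
  intro E _ _ φ hφ x hx
  refine ⟨fun y => f (φ y 0), ?_, fun _ _ => rfl⟩
  have hc : ContDiffAt ℝ ∞ (fun y => φ y 0) x :=
    contDiffAt_pi.2 fun i => (hφ 0 i).contDiffAt
  exact (hf.contDiffAt (hU.mem_nhds hx)).comp x hc

/-- The shift parameter `t` is added to the family as one more variable, giving a family over `E ×
ℝ`; differentiating a jointly smooth function in `t` keeps it smooth in `E`. Allowing arbitrary
parameter spaces in `IsSmooth` makes this possible. -/
lemma IsSmooth.pd (hU : IsOpen U) {F : DiffFun U} (hF : IsSmooth F) (s : ℕ) (i : Fin n) :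
    IsSmooth (pd s i F) := by
  obtain ⟨⟨N, hN⟩, hF⟩ := hF
  refine isSmooth_of_local hU (hN.pd s i) ?_
  intro E _ _ φ hφ x hx
  refine ⟨fun y => deriv (fun t => extend F (shift (φ y) s i t)) 0, ?_, fun _ _ => rfl⟩
  have h1 : ContDiffAt ℝ ∞ (Function.uncurry fun (y : E) (t : ℝ) =>
      extend F (shift (φ y) s i t)) (x, 0) :=
    hF (E × ℝ) (fun z => shift (φ z.1) s i z.2)
      (contDiff_shift (φ := fun z : E × ℝ => φ z.1) (fun r k => (hφ r k).comp contDiff_fst)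
        contDiff_snd s i) (x, 0) (by simpa using hx)
  have h2 := ContDiffAt.fderiv (m := ∞) (g := fun _ : E => (0 : ℝ)) h1 contDiffAt_const le_rfl
  exact h2.clm_apply contDiffAt_const

/-- The algebra of smooth differential functions of finite order. -/
def smoothAlg (hU : IsOpen U) : Subalgebra ℝ (DiffFun U) where
  carrier := {F | IsSmooth F}
  mul_mem' := IsSmooth.mul
  add_mem' := IsSmooth.add
  algebraMap_mem' a := isSmooth_const hU a

variable {hU : IsOpen U}

lemma pd_mem {F : DiffFun U} (hF : F ∈ smoothAlg hU) (s : ℕ) (i : Fin n) :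
    pd s i F ∈ smoothAlg hU := IsSmooth.pd hU hF s i

lemma jet_mem (s : ℕ) (i : Fin n) : jet s i ∈ smoothAlg hU := isSmooth_jet hU s i

lemma dx_mem {F : DiffFun U} (hF : F ∈ smoothAlg hU) : dx F ∈ smoothAlg hU := by
  obtain ⟨N, hN⟩ := hF.1
  rw [hN.dx_eq hU]
  exact sum_mem fun s _ => sum_mem fun i _ => mul_mem (jet_mem _ _) (pd_mem hF s i)

lemma iterate_dx_mem {F : DiffFun U} (hF : F ∈ smoothAlg hU) (r : ℕ) :
    dx^[r] F ∈ smoothAlg hU := by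
  induction r with
  | zero => exact hF
  | succ r ih => rw [Function.iterate_succ_apply']; exact dx_mem ih

lemma prolong_mem {X : VField U} (hX : ∀ i, X i ∈ smoothAlg hU) {F : DiffFun U}
    (hF : F ∈ smoothAlg hU) : prolong X F ∈ smoothAlg hU := by
  obtain ⟨N, hN⟩ := hF.1
  rw [hN.prolong_eq hU]
  exact sum_mem fun s _ => sum_mem fun i _ =>
    mul_mem (iterate_dx_mem (hX i) s) (pd_mem hF s i)

/-! ### The partial derivatives are commuting derivations -/

lemma differentiableAt_shift {F : DiffFun U} (hF : F ∈ smoothAlg hU) (J : Jet U) (s : ℕ)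
    (i : Fin n) : DifferentiableAt ℝ (fun t => extend F (shift J.1 s i t)) 0 :=
  (hF.2 ℝ (fun t => shift J.1 s i t) (contDiff_shift (φ := fun _ : ℝ => J.1)
    (fun _ _ => contDiff_const) contDiff_id s i) 0 (by simpa using J.2)).differentiableAt
      (by simp)

lemma pd_add {F G : DiffFun U} (hF : F ∈ smoothAlg hU) (hG : G ∈ smoothAlg hU) (s : ℕ)
    (i : Fin n) : pd s i (F + G) = pd s i F + pd s i G := by
  funext J
  simp only [Pi.add_apply, pd_def, extend_add]
  exact deriv_fun_add (differentiableAt_shift hF J s i) (differentiableAt_shift hG J s i)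

lemma pd_mul {F G : DiffFun U} (hF : F ∈ smoothAlg hU) (hG : G ∈ smoothAlg hU) (s : ℕ)
    (i : Fin n) : pd s i (F * G) = pd s i F * G + F * pd s i G := by
  funext J
  simp only [Pi.add_apply, Pi.mul_apply, pd_def, extend_mul]
  rw [deriv_fun_mul (differentiableAt_shift hF J s i) (differentiableAt_shift hG J s i)]
  simp [extend_coe]

lemma pd_const (hU : IsOpen U) (a : ℝ) (s : ℕ) (i : Fin n) :
    pd s i (fun _ : Jet U => a) = 0 := by
  funext J
  rw [pd_eq_deriv hU s i _ J (fun _ => a) fun _ _ => rfl]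
  simp

lemma pd_zero (s : ℕ) (i : Fin n) : pd s i (0 : DiffFun U) = 0 := by
  funext J
  have : ∀ K, extend (0 : DiffFun U) K = 0 := fun K => by simp [extend]
  simp [pd_def, this]

lemma pd_sum {ι : Type*} {T : Finset ι} {F : ι → DiffFun U}
    (h : ∀ a ∈ T, F a ∈ smoothAlg hU) (s : ℕ) (i : Fin n) :
    pd s i (∑ a ∈ T, F a) = ∑ a ∈ T, pd s i (F a) := by
  classical
  induction T using Finset.induction_on with
  | empty => simp [pd_zero]
  | insert a T ha ih =>
    rw [Finset.sum_insert ha, Finset.sum_insert ha, pd_add (hU := hU), ih]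
    · exact fun b hb => h b (Finset.mem_insert_of_mem hb)
    · exact h a (Finset.mem_insert_self _ _)
    · exact sum_mem fun b hb => h b (Finset.mem_insert_of_mem hb)

lemma pd_jet (hU : IsOpen U) (s r : ℕ) (i k : Fin n) :
    pd s i (jet r k : DiffFun U) = fun _ => if r = s ∧ k = i then 1 else 0 := by
  funext J
  rw [pd_eq_deriv hU s i _ J (fun t => J.1 r k + if r = s ∧ k = i then t else 0)
    fun t _ => shift_apply ..]
  by_cases h : r = s ∧ k = i <;> simp [h]

/-- Near the origin each inner derivative is `fderiv` applied to a basis vector, so both sides are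
values of the symmetric second derivative. -/
lemma deriv_deriv_comm {g : ℝ × ℝ → ℝ} (hg : ContDiffAt ℝ ∞ g (0, 0)) :
    deriv (fun a => deriv (fun b => g (a, b)) 0) 0
      = deriv (fun b => deriv (fun a => g (a, b)) 0) 0 := by
  have hev : ∀ᶠ z in 𝓝 ((0 : ℝ), (0 : ℝ)), DifferentiableAt ℝ g z := by
    have := (hg.of_le (m := 1) (by norm_cast)).eventually (by simp)
    filter_upwards [this] with z hz using hz.differentiableAt (by simp)
  have hd : DifferentiableAt ℝ (fderiv ℝ g) (0, 0) :=
    (hg.fderiv_right (m := ∞) le_rfl).differentiableAt (by simp)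
  have hsymm : IsSymmSndFDerivAt ℝ g (0, 0) := hg.isSymmSndFDerivAt
    (by rw [minSmoothness_of_isRCLikeNormedField]; norm_cast)
  have e1 : (fun a : ℝ => deriv (fun b => g (a, b)) 0) =ᶠ[𝓝 0]
      fun a => fderiv ℝ g (a, 0) (0, 1) := by
    have hc : Filter.Tendsto (fun a : ℝ => (a, (0 : ℝ))) (𝓝 0) (𝓝 (0, 0)) :=
      (Continuous.tendsto (by fun_prop) 0)
    filter_upwards [hc.eventually hev] with a ha
    have hl : HasDerivAt (fun b : ℝ => (a, b)) ((0 : ℝ), (1 : ℝ)) 0 :=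
      (hasDerivAt_const (0 : ℝ) a).prodMk (hasDerivAt_id 0)
    exact (ha.hasFDerivAt.comp_hasDerivAt (0 : ℝ) hl).deriv
  have e2 : (fun b : ℝ => deriv (fun a => g (a, b)) 0) =ᶠ[𝓝 0]
      fun b => fderiv ℝ g (0, b) (1, 0) := by
    have hc : Filter.Tendsto (fun b : ℝ => ((0 : ℝ), b)) (𝓝 0) (𝓝 (0, 0)) :=
      (Continuous.tendsto (by fun_prop) 0)
    filter_upwards [hc.eventually hev] with b hb
    have hl : HasDerivAt (fun a : ℝ => (a, b)) ((1 : ℝ), (0 : ℝ)) 0 :=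
      (hasDerivAt_id (0 : ℝ)).prodMk (hasDerivAt_const 0 b)
    exact (hb.hasFDerivAt.comp_hasDerivAt (0 : ℝ) hl).deriv
  rw [e1.deriv_eq, e2.deriv_eq]
  have l1 : HasDerivAt (fun a : ℝ => (a, (0 : ℝ))) ((1 : ℝ), (0 : ℝ)) 0 :=
    (hasDerivAt_id (0 : ℝ)).prodMk (hasDerivAt_const 0 0)
  have l2 : HasDerivAt (fun b : ℝ => ((0 : ℝ), b)) ((0 : ℝ), (1 : ℝ)) 0 :=
    (hasDerivAt_const (0 : ℝ) 0).prodMk (hasDerivAt_id 0)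
  have d1 := ((HasFDerivAt.comp_hasDerivAt (f := fun a : ℝ => (a, (0 : ℝ))) 0
    hd.hasFDerivAt l1).clm_apply
    (hasDerivAt_const (0 : ℝ) ((0 : ℝ), (1 : ℝ)))).deriv
  have d2 := ((HasFDerivAt.comp_hasDerivAt (f := fun b : ℝ => ((0 : ℝ), b)) 0
    hd.hasFDerivAt l2).clm_apply
    (hasDerivAt_const (0 : ℝ) ((1 : ℝ), (0 : ℝ)))).deriv
  simp only [Function.comp_apply, map_zero, add_zero] at d1 d2
  rw [d1, d2]
  exact hsymm _ _

lemma pd_comm {F : DiffFun U} (hF : F ∈ smoothAlg hU) (s r : ℕ) (i k : Fin n) :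
    pd s i (pd r k F) = pd r k (pd s i F) := by
  funext J
  have hg := hF.2 (ℝ × ℝ) (fun z => shift (shift J.1 s i z.1) r k z.2)
    (contDiff_shift (contDiff_shift (φ := fun _ : ℝ × ℝ => J.1) (fun _ _ => contDiff_const)
      contDiff_fst s i) contDiff_snd r k) (0, 0) (by simpa using J.2)
  rw [pd_eq_deriv hU s i (pd r k F) J
      (fun a => deriv (fun b => extend F (shift (shift J.1 s i a) r k b)) 0) fun _ _ => rfl,
    pd_eq_deriv hU r k (pd s i F) J
      (fun b => deriv (fun a => extend F (shift (shift J.1 s i a) r k b)) 0)]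
  · exact deriv_deriv_comm hg
  · intro t ht
    rw [pd_def]
    simp only [shift, add_right_comm]

/-! ### Translations along the diagonal -/

/-- The derivative along the diagonal vector field `∑_k ∂/∂u^k`. -/
def diagDeriv (F : DiffFun U) : DiffFun U := ∑ k, pd 0 k F

lemma diagDeriv_mem {F : DiffFun U} (hF : F ∈ smoothAlg hU) :
    diagDeriv F ∈ smoothAlg hU := sum_mem fun k _ => pd_mem hF 0 k

lemma diagDeriv_zero : diagDeriv (0 : DiffFun U) = 0 := by simp [diagDeriv, pd_zero]

lemma diagDeriv_const (hU : IsOpen U) (a : ℝ) : diagDeriv (fun _ : Jet U => a) = 0 := by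
  simp [diagDeriv, pd_const hU]

lemma diagDeriv_add {F G : DiffFun U} (hF : F ∈ smoothAlg hU) (hG : G ∈ smoothAlg hU) :
    diagDeriv (F + G) = diagDeriv F + diagDeriv G := by
  simp only [diagDeriv, pd_add hF hG, Finset.sum_add_distrib]

lemma diagDeriv_mul {F G : DiffFun U} (hF : F ∈ smoothAlg hU) (hG : G ∈ smoothAlg hU) :
    diagDeriv (F * G) = diagDeriv F * G + F * diagDeriv G := by
  simp only [diagDeriv, pd_mul hF hG, Finset.sum_add_distrib, Finset.sum_mul, Finset.mul_sum]

lemma diagDeriv_sum {ι : Type*} {T : Finset ι} {F : ι → DiffFun U}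
    (h : ∀ a ∈ T, F a ∈ smoothAlg hU) :
    diagDeriv (∑ a ∈ T, F a) = ∑ a ∈ T, diagDeriv (F a) := by
  simp only [diagDeriv, pd_sum h]
  exact Finset.sum_comm

lemma diagDeriv_const_mul (a : ℝ) {F : DiffFun U} (hF : F ∈ smoothAlg hU) :
    diagDeriv ((fun _ => a) * F) = (fun _ => a) * diagDeriv F := by
  rw [diagDeriv_mul (isSmooth_const hU a) hF, diagDeriv_const hU, zero_mul, zero_add]

lemma diagDeriv_neg {F : DiffFun U} (hF : F ∈ smoothAlg hU) :
    diagDeriv (-F) = -diagDeriv F := by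
  have e : ∀ G : DiffFun U, (fun _ => (-1 : ℝ)) * G = -G := fun G => by funext J; simp
  rw [← e, ← e, diagDeriv_const_mul (-1) hF]

lemma diagDeriv_sub {F G : DiffFun U} (hF : F ∈ smoothAlg hU) (hG : G ∈ smoothAlg hU) :
    diagDeriv (F - G) = diagDeriv F - diagDeriv G := by
  rw [sub_eq_add_neg, sub_eq_add_neg, diagDeriv_add hF (neg_mem hG), diagDeriv_neg hG]

/-- Differentiate `F * F⁻¹ = 1`. -/
lemma diagDeriv_inv {F : DiffFun U} (hF : F ∈ smoothAlg hU) (h0 : ∀ J, F J ≠ 0)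
    (hD : diagDeriv F = 0) : diagDeriv F⁻¹ = 0 := by
  have h1 : F * F⁻¹ = fun _ => 1 := by funext J; simp [h0 J]
  have h2 := congrArg diagDeriv h1
  rw [diagDeriv_const hU, diagDeriv_mul hF (IsSmooth.inv hF h0), hD, zero_mul, zero_add] at h2
  funext J
  simpa [h0 J] using congrFun h2 J

lemma diagDeriv_pd {F : DiffFun U} (hF : F ∈ smoothAlg hU) (s : ℕ) (i : Fin n) :
    diagDeriv (pd s i F) = pd s i (diagDeriv F) := by
  rw [diagDeriv, diagDeriv, pd_sum fun k _ => pd_mem hF 0 k]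
  exact Finset.sum_congr rfl fun k _ => pd_comm hF 0 s k i

lemma diagDeriv_jet_succ (hU : IsOpen U) (s : ℕ) (i : Fin n) :
    diagDeriv (jet (s + 1) i : DiffFun U) = 0 := by
  funext J
  simp [diagDeriv, pd_jet hU]

lemma diagDeriv_jet_zero (hU : IsOpen U) (i : Fin n) :
    diagDeriv (jet 0 i : DiffFun U) = fun _ => 1 := by
  funext J
  simp [diagDeriv, pd_jet hU]

lemma HasOrder.diagDeriv {N : ℕ} {F : DiffFun U} (h : HasOrder N F) :
    HasOrder N (diagDeriv F) := HasOrder.sum fun k _ => h.pd 0 k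

/-- The coefficients of `dx` are jets of order at least one, which diagonal translations do not
move. -/
lemma diagDeriv_dx {F : DiffFun U} (hF : F ∈ smoothAlg hU) :
    diagDeriv (dx F) = dx (diagDeriv F) := by
  obtain ⟨N, hN⟩ := hF.1
  rw [hN.dx_eq hU, hN.diagDeriv.dx_eq hU, diagDeriv_sum (hU := hU) fun s _ => sum_mem fun i _ =>
    mul_mem (jet_mem _ _) (pd_mem hF s i)]
  refine Finset.sum_congr rfl fun s _ => ?_
  rw [diagDeriv_sum (hU := hU) fun i _ => mul_mem (jet_mem _ _) (pd_mem hF s i)]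
  refine Finset.sum_congr rfl fun i _ => ?_
  rw [diagDeriv_mul (jet_mem _ _) (pd_mem hF s i), diagDeriv_jet_succ hU, zero_mul, zero_add,
    diagDeriv_pd hF]

lemma diagDeriv_iterate_dx {F : DiffFun U} (hF : F ∈ smoothAlg hU) (r : ℕ) :
    diagDeriv (dx^[r] F) = dx^[r] (diagDeriv F) := by
  induction r with
  | zero => rfl
  | succ r ih =>
    rw [Function.iterate_succ_apply', Function.iterate_succ_apply',
      diagDeriv_dx (iterate_dx_mem hF r), ih]

/-- The commutator of the diagonal field with the prolongation of `X` is the prolongation of the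
diagonal derivative of `X`. -/
lemma diagDeriv_prolong {X : VField U} (hX : ∀ i, X i ∈ smoothAlg hU) {F : DiffFun U}
    (hF : F ∈ smoothAlg hU) : diagDeriv (prolong X F)
      = prolong (fun i => diagDeriv (X i)) F + prolong X (diagDeriv F) := by
  obtain ⟨N, hN⟩ := hF.1
  have hm : ∀ s i, dx^[s] (X i) * pd s i F ∈ smoothAlg hU := fun s i =>
    mul_mem (iterate_dx_mem (hX i) s) (pd_mem hF s i)
  rw [hN.prolong_eq hU, hN.prolong_eq hU, hN.diagDeriv.prolong_eq hU, ← Finset.sum_add_distrib,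
    diagDeriv_sum (hU := hU) fun s _ => sum_mem fun i _ => hm s i]
  refine Finset.sum_congr rfl fun s _ => ?_
  rw [diagDeriv_sum (hU := hU) fun i _ => hm s i, ← Finset.sum_add_distrib]
  refine Finset.sum_congr rfl fun i _ => ?_
  rw [diagDeriv_mul (iterate_dx_mem (hX i) s) (pd_mem hF s i), diagDeriv_iterate_dx (hX i),
    diagDeriv_pd hF]

/-! ### Coefficients of differential operators -/

lemma iterate_dx_zero (r : ℕ) : dx^[r] (0 : DiffFun U) = 0 := by
  induction r with
  | zero => rfl
  | succ r ih =>
    rw [Function.iterate_succ_apply', ih]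
    funext J
    simp [dx, pd_zero]

lemma prolong_zero (X : VField U) : prolong X (0 : DiffFun U) = 0 := by
  funext J
  simp [prolong, pd_zero]

/-- Bounds replace supports in the coefficient formulas, because a diagonal derivative may shrink
the support but respects any bound. -/
lemma exists_bound (P : DiffOp U) : ∃ N, ∀ a, N ≤ a → P a = 0 := by
  refine ⟨P.support.sup id + 1, fun a ha => ?_⟩
  by_contra h
  have : a ≤ P.support.sup id := Finset.le_sup (f := id) (Finsupp.mem_support_iff.2 h)
  omega

lemma support_subset_range {P : DiffOp U} {N : ℕ} (h : ∀ a, N ≤ a → P a = 0) :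
    P.support ⊆ Finset.range N := fun a ha => by
  by_contra hN
  exact Finsupp.mem_support_iff.1 ha (h a (by simpa using hN))

lemma comp_coeff {P Q : DiffOp U} {N M : ℕ} (hP : ∀ a, N ≤ a → P a = 0)
    (hQ : ∀ a, M ≤ a → Q a = 0) (m : ℕ) :
    comp P Q m = ∑ a ∈ Finset.range N, ∑ b ∈ Finset.range M, ∑ r ∈ Finset.range (a + 1),
      if a + b - r = m then ((a.choose r : ℕ) : DiffFun U) * P a * dx^[r] (Q b) else 0 := by
  rw [comp, Finsupp.sum_of_support_subset _ (support_subset_range hP) _ (by simp),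
    Finsupp.finsetSum_apply]
  refine Finset.sum_congr rfl fun a _ => ?_
  rw [Finsupp.sum_of_support_subset _ (support_subset_range hQ) _
    (by simp [iterate_dx_zero]), Finsupp.finsetSum_apply]
  refine Finset.sum_congr rfl fun b _ => ?_
  rw [Finsupp.finsetSum_apply]
  exact Finset.sum_congr rfl fun r _ => Finsupp.single_apply

lemma adjoint_coeff {P : DiffOp U} {N : ℕ} (hP : ∀ a, N ≤ a → P a = 0) (m : ℕ) :
    adjoint P m = ∑ a ∈ Finset.range N, ∑ r ∈ Finset.range (a + 1),
      if a - r = m then (-1) ^ a * ((a.choose r : ℕ) : DiffFun U) * dx^[r] (P a) else 0 := by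
  rw [adjoint, Finsupp.sum_of_support_subset _ (support_subset_range hP) _
    (by simp [iterate_dx_zero]), Finsupp.finsetSum_apply]
  refine Finset.sum_congr rfl fun a _ => ?_
  rw [Finsupp.finsetSum_apply]
  exact Finset.sum_congr rfl fun r _ => Finsupp.single_apply

lemma prolongOp_coeff (X : VField U) (P : DiffOp U) (m : ℕ) :
    prolongOp X P m = prolong X (P m) := by
  rw [prolongOp, Finsupp.sum_apply]
  simp only [Finsupp.single_apply]
  rw [Finsupp.sum_ite_eq']
  by_cases h : m ∈ P.support
  · simp [h]
  · simp [Finsupp.notMem_support_iff.1 h, prolong_zero]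

lemma HasOrder.frechet_coeff (hU : IsOpen U) {N : ℕ} {F : DiffFun U} (h : HasOrder N F)
    (k : Fin n) (s : ℕ) : frechet F k s = LoopSpace.pd s k F := by
  have : frechet F k = ∑ s ∈ Finset.range (N + 1), Finsupp.single s (LoopSpace.pd s k F) := by
    refine finsum_eq_sum_of_support_subset _ fun s hs => ?_
    by_contra hN
    simp only [Finset.coe_range, Set.mem_Iio, not_lt] at hN
    exact hs (by simp [h.pd_eq_zero hU (show N < s by omega)])
  rw [this, Finsupp.finsetSum_apply]
  simp only [Finsupp.single_apply]
  rw [Finset.sum_ite_eq']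
  by_cases hs : s ∈ Finset.range (N + 1)
  · simp [hs]
  · rw [if_neg hs, h.pd_eq_zero hU (by simpa using hs)]

lemma frechet_coeff {F : DiffFun U} (hF : F ∈ smoothAlg hU) (k : Fin n) (s : ℕ) :
    frechet F k s = pd s k F := by
  obtain ⟨N, hN⟩ := hF.1
  exact hN.frechet_coeff hU k s

lemma comp_zero_left (Q : DiffOp U) : comp 0 Q = 0 := by simp [comp]

lemma comp_zero_right (P : DiffOp U) : comp P 0 = 0 := by simp [comp]

lemma adjoint_zero : adjoint (0 : DiffOp U) = 0 := by simp [adjoint]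

lemma frechet_mem {F : DiffFun U} (hF : F ∈ smoothAlg hU) (k : Fin n) (s : ℕ) :
    frechet F k s ∈ smoothAlg hU := by
  rw [frechet_coeff hF]
  exact pd_mem hF s k

lemma natCast_mul_mul_mem (c : ℕ) {F G : DiffFun U} (hF : F ∈ smoothAlg hU)
    (hG : G ∈ smoothAlg hU) : (c : DiffFun U) * F * G ∈ smoothAlg hU :=
  mul_mem (mul_mem (natCast_mem _ c) hF) hG

lemma comp_mem {P Q : DiffOp U} (hP : ∀ a, P a ∈ smoothAlg hU) (hQ : ∀ a, Q a ∈ smoothAlg hU)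
    (m : ℕ) : comp P Q m ∈ smoothAlg hU := by
  obtain ⟨N, hN⟩ := exists_bound P
  obtain ⟨M, hM⟩ := exists_bound Q
  rw [comp_coeff hN hM]
  refine sum_mem fun a _ => sum_mem fun b _ => sum_mem fun r _ => ?_
  split_ifs
  · exact natCast_mul_mul_mem _ (hP a) (iterate_dx_mem (hQ b) r)
  · exact zero_mem _

lemma adjoint_mem {P : DiffOp U} (hP : ∀ a, P a ∈ smoothAlg hU) (m : ℕ) :
    adjoint P m ∈ smoothAlg hU := by
  obtain ⟨N, hN⟩ := exists_bound P
  rw [adjoint_coeff hN]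
  refine sum_mem fun a _ => sum_mem fun r _ => ?_
  split_ifs
  · exact mul_mem (mul_mem (pow_mem (neg_mem (one_mem _)) a) (natCast_mem _ _))
      (iterate_dx_mem (hP a) r)
  · exact zero_mem _

lemma lieDeriv_coeff (X : VField U) (P : Bivector U) (i j : Fin n) (m : ℕ) :
    lieDeriv X P i j m = prolong X (P i j m) - ∑ k, comp (frechet (X i) k) (P k j) m
      - ∑ k, comp (P i k) (adjoint (frechet (X j) k)) m := by
  simp only [lieDeriv, Finsupp.sub_apply, Finsupp.finsetSum_apply, prolongOp_coeff]

/-! ### The diagonal derivative of operators and bivectors -/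

/-- The diagonal derivative, applied to the coefficients of an operator. -/
def diagDerivOp (P : DiffOp U) : DiffOp U := P.mapRange diagDeriv diagDeriv_zero

@[simp] lemma diagDerivOp_apply (P : DiffOp U) (a : ℕ) : diagDerivOp P a = diagDeriv (P a) :=
  Finsupp.mapRange_apply

lemma diagDerivOp_bound {P : DiffOp U} {N : ℕ} (h : ∀ a, N ≤ a → P a = 0) (a : ℕ)
    (ha : N ≤ a) : diagDerivOp P a = 0 := by
  simp [h a ha, diagDeriv_zero]

lemma diagDeriv_comp {P Q : DiffOp U} (hP : ∀ a, P a ∈ smoothAlg hU)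
    (hQ : ∀ a, Q a ∈ smoothAlg hU) (m : ℕ) : diagDeriv (comp P Q m)
      = comp (diagDerivOp P) Q m + comp P (diagDerivOp Q) m := by
  obtain ⟨N, hN⟩ := exists_bound P
  obtain ⟨M, hM⟩ := exists_bound Q
  have key : ∀ a b r, (if a + b - r = m then
      ((a.choose r : ℕ) : DiffFun U) * P a * dx^[r] (Q b) else 0) ∈ smoothAlg hU := by
    intro a b r
    split_ifs
    · exact natCast_mul_mul_mem _ (hP a) (iterate_dx_mem (hQ b) r)
    · exact zero_mem _
  rw [comp_coeff hN hM, comp_coeff (diagDerivOp_bound hN) hM,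
    comp_coeff hN (diagDerivOp_bound hM), ← Finset.sum_add_distrib,
    diagDeriv_sum (hU := hU) fun a _ => sum_mem fun b _ => sum_mem fun r _ => key a b r]
  refine Finset.sum_congr rfl fun a _ => ?_
  rw [← Finset.sum_add_distrib,
    diagDeriv_sum (hU := hU) fun b _ => sum_mem fun r _ => key a b r]
  refine Finset.sum_congr rfl fun b _ => ?_
  rw [← Finset.sum_add_distrib, diagDeriv_sum (hU := hU) fun r _ => key a b r]
  refine Finset.sum_congr rfl fun r _ => ?_
  split_ifs
  · have hc : diagDeriv ((a.choose r : ℕ) : DiffFun U) = 0 := diagDeriv_const hU _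
    rw [diagDeriv_mul (mul_mem (natCast_mem _ _) (hP a)) (iterate_dx_mem (hQ b) r),
      diagDeriv_mul (natCast_mem (smoothAlg hU) _) (hP a), hc, zero_mul, zero_add,
      diagDeriv_iterate_dx (hQ b)]
    simp only [diagDerivOp_apply]
  · simp [diagDeriv_zero]

lemma diagDerivOp_adjoint {P : DiffOp U} (hP : ∀ a, P a ∈ smoothAlg hU) :
    diagDerivOp (adjoint P) = adjoint (diagDerivOp P) := by
  obtain ⟨N, hN⟩ := exists_bound P
  ext1 m
  have hc : ∀ a r : ℕ, (-1) ^ a * ((a.choose r : ℕ) : DiffFun U) ∈ smoothAlg hU := fun a r =>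
    mul_mem (pow_mem (neg_mem (one_mem _)) a) (natCast_mem _ _)
  have key : ∀ a r, (if a - r = m then
      (-1) ^ a * ((a.choose r : ℕ) : DiffFun U) * dx^[r] (P a) else 0) ∈ smoothAlg hU := by
    intro a r
    split_ifs
    · exact mul_mem (hc a r) (iterate_dx_mem (hP a) r)
    · exact zero_mem _
  rw [diagDerivOp_apply, adjoint_coeff hN, adjoint_coeff (diagDerivOp_bound hN),
    diagDeriv_sum (hU := hU) fun a _ => sum_mem fun r _ => key a r]
  refine Finset.sum_congr rfl fun a _ => ?_
  rw [diagDeriv_sum (hU := hU) fun r _ => key a r]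
  refine Finset.sum_congr rfl fun r _ => ?_
  split_ifs
  · have hd : diagDeriv ((-1) ^ a * ((a.choose r : ℕ) : DiffFun U)) = 0 :=
      diagDeriv_const hU ((-1) ^ a * ((a.choose r : ℕ) : ℝ))
    rw [diagDeriv_mul (hc a r) (iterate_dx_mem (hP a) r), hd, zero_mul, zero_add,
      diagDeriv_iterate_dx (hP a), diagDerivOp_apply]
  · exact diagDeriv_zero

lemma diagDerivOp_frechet {F : DiffFun U} (hF : F ∈ smoothAlg hU) (k : Fin n) :
    diagDerivOp (frechet F k) = frechet (diagDeriv F) k := by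
  ext1 s
  rw [diagDerivOp_apply, frechet_coeff hF, frechet_coeff (diagDeriv_mem hF), diagDeriv_pd hF]

/-- The diagonal derivative of a bivector. -/
def diagDerivBi (P : Bivector U) : Bivector U := fun i j => diagDerivOp (P i j)

/-- This is `Lie_e Lie_X = Lie_{[e, X]} + Lie_X Lie_e` for the diagonal field `e`; it follows from
the Leibniz rule, since the diagonal derivative commutes with compositions, adjoints and Fréchet
derivatives. -/
lemma diagDerivBi_lieDeriv {X : VField U} (hX : ∀ i, X i ∈ smoothAlg hU) {P : Bivector U}
    (hP : ∀ i j a, P i j a ∈ smoothAlg hU) : diagDerivBi (lieDeriv X P)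
      = lieDeriv (fun i => diagDeriv (X i)) P + lieDeriv X (diagDerivBi P) := by
  funext i j
  ext1 m
  have h1 : ∀ k, comp (frechet (X i) k) (P k j) m ∈ smoothAlg hU := fun k =>
    comp_mem (frechet_mem (hX i) k) (hP k j) m
  have h2 : ∀ k, comp (P i k) (adjoint (frechet (X j) k)) m ∈ smoothAlg hU := fun k =>
    comp_mem (hP i k) (adjoint_mem (frechet_mem (hX j) k)) m
  have h3 := prolong_mem hX (hP i j m)
  simp only [diagDerivBi, Pi.add_apply, Finsupp.add_apply, diagDerivOp_apply]
  simp only [lieDeriv_coeff]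
  rw [diagDeriv_sub (sub_mem h3 (sum_mem fun k _ => h1 k)) (sum_mem fun k _ => h2 k),
    diagDeriv_sub h3 (sum_mem fun k _ => h1 k), diagDeriv_sum (hU := hU) fun k _ => h1 k,
    diagDeriv_sum (hU := hU) fun k _ => h2 k, diagDeriv_prolong hX (hP i j m)]
  have e1 : ∀ k, diagDeriv (comp (frechet (X i) k) (P k j) m)
      = comp (frechet (diagDeriv (X i)) k) (P k j) m
        + comp (frechet (X i) k) (diagDerivOp (P k j)) m := fun k => by
    rw [diagDeriv_comp (frechet_mem (hX i) k) (hP k j), diagDerivOp_frechet (hX i)]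
  have e2 : ∀ k, diagDeriv (comp (P i k) (adjoint (frechet (X j) k)) m)
      = comp (diagDerivOp (P i k)) (adjoint (frechet (X j) k)) m
        + comp (P i k) (adjoint (frechet (diagDeriv (X j)) k)) m := fun k => by
    rw [diagDeriv_comp (hP i k) (adjoint_mem (frechet_mem (hX j) k)),
      diagDerivOp_adjoint (frechet_mem (hX j) k), diagDerivOp_frechet (hX j)]
  simp only [e1, e2, Finset.sum_add_distrib, diagDerivBi, diagDerivOp_apply]
  abel

lemma lieDeriv_zero_right (X : VField U) : lieDeriv X 0 = 0 := by
  funext i j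
  ext1 m
  simp [lieDeriv_coeff, prolong_zero, comp_zero_left, comp_zero_right]

lemma frechet_const (hU : IsOpen U) (a : ℝ) (k : Fin n) :
    frechet (fun _ : Jet U => a) k = 0 := by
  ext1 s
  rw [frechet_coeff (hU := hU) (isSmooth_const hU a), pd_const hU]
  rfl

lemma lieDeriv_zero_left (hU : IsOpen U) (P : Bivector U) : lieDeriv 0 P = 0 := by
  have h0 : ∀ k, frechet (0 : DiffFun U) k = 0 := frechet_const hU 0
  funext i j
  ext1 m
  have hp : prolong (0 : VField U) (P i j m) = 0 := by
    funext J
    simp [prolong, iterate_dx_zero]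
  simp [lieDeriv_coeff, h0, hp, comp_zero_left, comp_zero_right, adjoint_zero]

lemma dx_const (hU : IsOpen U) (a : ℝ) : dx (fun _ : Jet U => a) = 0 := by
  funext J
  simp [dx, pd_const hU]

/-- Constant components have zero total and Fréchet derivatives, so only the `s = 0` term of the
prolongation survives. -/
lemma lieDeriv_liftVec_of_eq_one (hU : IsOpen U) {e : (Fin n → ℝ) → Fin n → ℝ}
    (he : ∀ u ∈ U, ∀ i, e u i = 1) (P : Bivector U) :
    lieDeriv (liftVec e) P = diagDerivBi P := by
  have h1 : ∀ i, (liftVec e : VField U) i = fun _ => 1 := fun i => by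
    funext J
    exact he _ J.2 i
  funext i j
  ext1 m
  have hp : prolong (liftVec e) (P i j m) = diagDeriv (P i j m) := by
    funext J
    simp only [prolong, diagDeriv, Finset.sum_apply]
    rw [finsum_eq_single _ 0]
    · simp [h1]
    · intro s hs
      obtain ⟨r, rfl⟩ := Nat.exists_eq_succ_of_ne_zero hs
      simp [h1, Function.iterate_succ_apply, dx_const hU, iterate_dx_zero]
  simp [lieDeriv_coeff, h1, frechet_const hU, hp, comp_zero_left, comp_zero_right,
    adjoint_zero, diagDerivBi]

/-! ### Leading coefficients of Lie derivatives of first order bivectors -/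

/-- Every `∂_x` that falls on a coefficient of `Q` lowers the order, so only `r = 0` in the product
of the top terms reaches order `A + B`. -/
lemma comp_coeff_top {P Q : DiffOp U} {A B : ℕ} (hP : ∀ a, A < a → P a = 0)
    (hQ : ∀ b, B < b → Q b = 0) : comp P Q (A + B) = P A * Q B := by
  rw [comp_coeff (N := A + 1) (M := B + 1) (fun a ha => hP a ha) (fun b hb => hQ b hb)]
  have hlow : ∀ a b r : ℕ, a ≤ A → b ≤ B → (a ≠ A ∨ b ≠ B ∨ r ≠ 0) → r ≤ a →
      a + b - r ≠ A + B := by omega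
  rw [Finset.sum_eq_single A, Finset.sum_eq_single B, Finset.sum_eq_single 0]
  · rw [if_pos (Nat.sub_zero _), Nat.choose_zero_right, Nat.cast_one, one_mul]
    rfl
  · intro r hr h
    exact if_neg (hlow A B r le_rfl le_rfl (Or.inr (Or.inr h))
      (Nat.lt_succ_iff.1 (Finset.mem_range.1 hr)))
  · simp
  · intro b hb h
    refine Finset.sum_eq_zero fun r hr => if_neg (hlow A b r le_rfl ?_ (Or.inr (Or.inl h)) ?_)
    · exact Nat.lt_succ_iff.1 (Finset.mem_range.1 hb)
    · exact Nat.lt_succ_iff.1 (Finset.mem_range.1 hr)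
  · simp
  · intro a ha h
    refine Finset.sum_eq_zero fun b hb => Finset.sum_eq_zero fun r hr =>
      if_neg (hlow a b r ?_ ?_ (Or.inl h) ?_)
    · exact Nat.lt_succ_iff.1 (Finset.mem_range.1 ha)
    · exact Nat.lt_succ_iff.1 (Finset.mem_range.1 hb)
    · exact Nat.lt_succ_iff.1 (Finset.mem_range.1 hr)
  · simp

lemma adjoint_coeff_of_gt {P : DiffOp U} {A : ℕ} (hP : ∀ a, A < a → P a = 0) {m : ℕ}
    (hm : A < m) : adjoint P m = 0 := by
  rw [adjoint_coeff (N := A + 1) fun a ha => hP a ha]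
  refine Finset.sum_eq_zero fun a h => Finset.sum_eq_zero fun r _ => if_neg ?_
  have := Finset.mem_range.1 h
  omega

lemma adjoint_coeff_top {P : DiffOp U} {A : ℕ} (hP : ∀ a, A < a → P a = 0) :
    adjoint P A = (-1) ^ A * P A := by
  rw [adjoint_coeff (N := A + 1) fun a ha => hP a ha, Finset.sum_eq_single A,
    Finset.sum_eq_single 0]
  · rw [if_pos (Nat.sub_zero _), Nat.choose_zero_right, Nat.cast_one, mul_one]
    rfl
  · intro r hr h
    refine if_neg ?_
    have := Finset.mem_range.1 hr
    omega
  · simp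
  · intro a ha h
    refine Finset.sum_eq_zero fun r hr => if_neg ?_
    have := Finset.mem_range.1 ha
    omega
  · simp

/-- Used with `A = 0` to determine the exact field and with `A = 2` to recover the parameters from
the standard form. -/
lemma lieDeriv_coeff_top (hU : IsOpen U) {A : ℕ} {X : VField U} (hX : ∀ i, HasOrder A (X i))
    {P : Bivector U} (hP : ∀ i j a, 1 < a → P i j a = 0) (i j : Fin n) :
    lieDeriv X P i j (A + 1) = prolong X (P i j (A + 1)) - ∑ k, pd A k (X i) * P k j 1
      - ∑ k, P i k 1 * ((-1) ^ A * pd A k (X j)) := by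
  have hf : ∀ i k a, A < a → frechet (X i) k a = 0 := fun i k a ha => by
    rw [(hX i).frechet_coeff hU, (hX i).pd_eq_zero hU ha]
  have h1 : ∀ k, comp (frechet (X i) k) (P k j) (A + 1) = pd A k (X i) * P k j 1 := fun k => by
    rw [comp_coeff_top (hf i k) (hP k j), (hX i).frechet_coeff hU]
  have h2 : ∀ k, comp (P i k) (adjoint (frechet (X j) k)) (A + 1)
      = P i k 1 * ((-1) ^ A * pd A k (X j)) := fun k => by
    rw [add_comm, comp_coeff_top (hP i k) fun m hm => adjoint_coeff_of_gt (hf j k) hm,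
      adjoint_coeff_top (hf j k), (hX j).frechet_coeff hU]
  rw [lieDeriv_coeff]
  simp only [h1, h2]

/-! ### Contravariant Christoffel symbols -/

lemma partialDeriv_congr {f g : (Fin n → ℝ) → ℝ} {p : Fin n → ℝ} (h : f =ᶠ[𝓝 p] g)
    (k : Fin n) : partialDeriv k f p = partialDeriv k g p := by
  rw [partialDeriv, partialDeriv, h.fderiv_eq]

lemma det_updateCol_eq_sum (A : Matrix (Fin n) (Fin n) ℝ) (i : Fin n) (v : Fin n → ℝ) :
    (A.updateCol i v).det = ∑ σ : Equiv.Perm (Fin n), (Equiv.Perm.sign σ : ℝ) *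
      ((∏ j ∈ Finset.univ.erase i, A (σ j) j) * v (σ i)) := by
  rw [Matrix.det_apply']
  refine Finset.sum_congr rfl fun σ _ => ?_
  rw [← Finset.prod_erase_mul _ _ (Finset.mem_univ i), Matrix.updateCol_self]
  congr 2
  refine Finset.prod_congr rfl fun j hj => ?_
  rw [Matrix.updateCol_ne (Finset.ne_of_mem_erase hj)]

section Metric

variable {G : (Fin n → ℝ) → Matrix (Fin n) (Fin n) ℝ} {p : Fin n → ℝ}

lemma hasFDerivAt_det (hG : ∀ i j, DifferentiableAt ℝ (fun u => G u i j) p) :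
    HasFDerivAt (fun u => (G u).det) (∑ σ : Equiv.Perm (Fin n), (Equiv.Perm.sign σ : ℝ) •
      ∑ i, (∏ j ∈ Finset.univ.erase i, G p (σ j) j) • fderiv ℝ (fun u => G u (σ i) i) p) p := by
  simp only [Matrix.det_apply']
  exact HasFDerivAt.fun_sum fun σ _ =>
    (HasFDerivAt.finsetProd fun i _ => (hG (σ i) i).hasFDerivAt).const_mul _

/-- Jacobi's formula. -/
lemma partialDeriv_det (hG : ∀ i j, DifferentiableAt ℝ (fun u => G u i j) p) (k : Fin n) :
    partialDeriv k (fun u => (G u).det) p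
      = ∑ i, ∑ j, (G p).adjugate j i * partialDeriv k (fun u => G u i j) p := by
  rw [partialDeriv, (hasFDerivAt_det hG).fderiv]
  have e : ∀ j, ∑ i, (G p).adjugate j i * partialDeriv k (fun u => G u i j) p
      = ((G p).updateCol j fun i => partialDeriv k (fun u => G u i j) p).det := fun j => by
    rw [← Matrix.cramer_apply, Matrix.cramer_eq_adjugate_mulVec]
    rfl
  rw [Finset.sum_comm]
  simp only [e, det_updateCol_eq_sum]
  rw [Finset.sum_comm]
  simp [Finset.mul_sum, partialDeriv]

lemma differentiableAt_adjugate (hG : ∀ i j, DifferentiableAt ℝ (fun u => G u i j) p)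
    (i j : Fin n) : DifferentiableAt ℝ (fun u => (G u).adjugate i j) p := by
  simp only [Matrix.adjugate_apply]
  refine (hasFDerivAt_det (G := fun u => (G u).updateRow j (Pi.single i 1)) fun a b => ?_)
    |>.differentiableAt
  by_cases h : a = j
  · subst h
    simp
  · simpa [Matrix.updateRow_ne h] using hG a b

lemma differentiableAt_matrix_inv (hG : ∀ i j, DifferentiableAt ℝ (fun u => G u i j) p)
    (hdet : (G p).det ≠ 0) (i j : Fin n) : DifferentiableAt ℝ (fun u => (G u)⁻¹ i j) p := by
  simp only [Matrix.inv_def, Ring.inverse_eq_inv', Matrix.smul_apply, smul_eq_mul]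
  exact ((hasFDerivAt_det hG).differentiableAt.inv hdet).mul (differentiableAt_adjugate hG i j)

lemma partialDeriv_inv_symm (hsymm : ∀ᶠ u in 𝓝 p, (G u).IsSymm) (k i j : Fin n) :
    partialDeriv k (fun u => (G u)⁻¹ i j) p = partialDeriv k (fun u => (G u)⁻¹ j i) p := by
  refine partialDeriv_congr ?_ k
  filter_upwards [hsymm] with u hu
  have : (G u)⁻¹.transpose = (G u)⁻¹ := by
    rw [Matrix.transpose_nonsing_inv, (hu : (G u).transpose = G u)]
  exact congrFun (congrFun this j) i

/-- Differentiate `G * G⁻¹ = 1`, which holds near `p` because the determinant stays nonzero there.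
-/
lemma partialDeriv_metric (hG : ∀ i j, DifferentiableAt ℝ (fun u => G u i j) p)
    (hdet : (G p).det ≠ 0) (k : Fin n) :
    (Matrix.of fun i j => partialDeriv k (fun u => G u i j) p)
      = - (G p * (Matrix.of fun i j => partialDeriv k (fun u => (G u)⁻¹ i j) p) * G p) := by
  set dG := Matrix.of fun i j => partialDeriv k (fun u => G u i j) p
  set dh := Matrix.of fun i j => partialDeriv k (fun u => (G u)⁻¹ i j) p
  have hu : IsUnit (G p).det := hdet.isUnit
  have key : dG * (G p)⁻¹ + G p * dh = 0 := by
    ext i j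
    have hev : (fun u => ∑ l, G u i l * (G u)⁻¹ l j)
        =ᶠ[𝓝 p] fun _ => (1 : Matrix (Fin n) (Fin n) ℝ) i j := by
      filter_upwards [(hasFDerivAt_det hG).continuousAt.eventually_ne hdet] with u hu
      rw [← Matrix.mul_nonsing_inv (G u) hu.isUnit, Matrix.mul_apply]
    have h0 := partialDeriv_congr hev k
    have hd : HasFDerivAt (fun u => ∑ l, G u i l * (G u)⁻¹ l j) _ p :=
      HasFDerivAt.fun_sum fun l (_ : l ∈ Finset.univ) => (hG i l).hasFDerivAt.mul
        (differentiableAt_matrix_inv hG hdet l j).hasFDerivAt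
    rw [partialDeriv, hd.fderiv] at h0
    simp only [partialDeriv, fderiv_fun_const, _root_.sum_apply,
      _root_.add_apply, _root_.smul_apply, smul_eq_mul,
      Finset.sum_add_distrib, Pi.zero_apply, _root_.zero_apply] at h0
    rw [Matrix.add_apply, Matrix.mul_apply, Matrix.mul_apply, Matrix.zero_apply, ← h0, add_comm]
    congr 1
    exact Finset.sum_congr rfl fun l _ => mul_comm _ _
  calc dG = dG * ((G p)⁻¹ * G p) := by rw [Matrix.nonsing_inv_mul _ hu, Matrix.mul_one]
    _ = (dG * (G p)⁻¹ + G p * dh) * G p - G p * dh * G p := by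
      rw [add_mul, add_sub_cancel_right, Matrix.mul_assoc]
    _ = _ := by rw [key, Matrix.zero_mul, zero_sub]

/-- Compatibility of the connection with the metric: in the sum the two antisymmetric contributions
cancel, leaving `-G (∂_k G⁻¹) G`. -/
lemma contraChristoffel_add (hG : ∀ i j, DifferentiableAt ℝ (fun u => G u i j) p)
    (hsymm : ∀ᶠ u in 𝓝 p, (G u).IsSymm) (hdet : (G p).det ≠ 0) (i j k : Fin n) :
    contraChristoffel G i j k p + contraChristoffel G j i k p
      = partialDeriv k (fun u => G u i j) p := by
  have hm := congrFun (congrFun (partialDeriv_metric hG hdet k) i) j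
  rw [Matrix.of_apply, Matrix.neg_apply, Matrix.mul_assoc, Matrix.mul_apply] at hm
  have hs : ∀ a b, G p a b = G p b a := fun a b =>
    congrFun (congrFun hsymm.self_of_nhds b) a
  have hX := fun l a b => partialDeriv_inv_symm hsymm l a b
  set X := fun l a b : Fin n => partialDeriv l (fun u => (G u)⁻¹ a b) p with hXdef
  have e1 : contraChristoffel G i j k p
      = ∑ l, ∑ m, -(1 / 2) * (G p i l * G p j m * (X l m k + X k m l - X m l k)) := by
    rw [contraChristoffel, ← Finset.sum_neg_distrib]
    refine Finset.sum_congr rfl fun l _ => ?_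
    rw [christoffel, Finset.mul_sum, Finset.mul_sum, ← Finset.sum_neg_distrib]
    refine Finset.sum_congr rfl fun m _ => ?_
    simp only [hXdef]
    ring
  have e2 : contraChristoffel G j i k p
      = ∑ l, ∑ m, -(1 / 2) * (G p i l * G p j m * (X m l k + X k l m - X l m k)) := by
    rw [contraChristoffel, Finset.sum_comm, ← Finset.sum_neg_distrib]
    refine Finset.sum_congr rfl fun l _ => ?_
    rw [christoffel, Finset.mul_sum, Finset.mul_sum, ← Finset.sum_neg_distrib]
    refine Finset.sum_congr rfl fun m _ => ?_
    simp only [hXdef]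
    ring
  rw [hm, e1, e2, ← Finset.sum_add_distrib, ← Finset.sum_neg_distrib]
  refine Finset.sum_congr rfl fun l _ => ?_
  rw [← Finset.sum_add_distrib, Matrix.mul_apply, Finset.mul_sum, ← Finset.sum_neg_distrib]
  refine Finset.sum_congr rfl fun m _ => ?_
  rw [Matrix.of_apply, hs m j]
  have := hX k l m
  simp only [hXdef]
  rw [this]
  ring

/-- Vanishing torsion: both sides contract the lower indices of a symmetric Christoffel symbol with
two copies of the metric. -/
lemma metric_contraChristoffel_symm (hsymm : ∀ᶠ u in 𝓝 p, (G u).IsSymm) (i j k : Fin n) :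
    ∑ s, G p i s * contraChristoffel G j k s p = ∑ s, G p j s * contraChristoffel G i k s p := by
  have hc : ∀ l s, christoffel G k l s p = christoffel G k s l p := fun l s => by
    rw [christoffel, christoffel]
    congr 1
    refine Finset.sum_congr rfl fun m _ => ?_
    rw [partialDeriv_inv_symm hsymm m l s]
    ring
  simp only [contraChristoffel, mul_neg, Finset.mul_sum, Finset.sum_neg_distrib]
  rw [Finset.sum_comm]
  congr 1
  refine Finset.sum_congr rfl fun s _ => Finset.sum_congr rfl fun l _ => ?_
  rw [hc]
  ring

end Metric

/-! ### Canonical coordinates diagonalize the pencil -/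

namespace HydroPencil.IsSemisimple

variable {H : HydroPencil n}

lemma metric_differentiableAt (hU : IsOpen U) (hH : H.IsSemisimple U) {p : Fin n → ℝ}
    (hp : p ∈ U) (μ : ℝ) (i j : Fin n) :
    DifferentiableAt ℝ (fun u => H.metric μ u i j) p := by
  have h1 := ((hH.smooth_g₁ i j).contDiffAt (hU.mem_nhds hp)).differentiableAt (by simp)
  have h2 := ((hH.smooth_g₂ i j).contDiffAt (hU.mem_nhds hp)).differentiableAt (by simp)
  simp only [HydroPencil.metric, Matrix.sub_apply, Matrix.smul_apply, smul_eq_mul]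
  exact h2.sub (h1.const_mul μ)

lemma metric_isSymm (hH : H.IsSemisimple U) {p : Fin n → ℝ} (hp : p ∈ U) (μ : ℝ) :
    (H.metric μ p).IsSymm :=
  (hH.symm_g₂ p hp).sub ((hH.symm_g₁ p hp).smul μ)

lemma eventually_metric_isSymm (hU : IsOpen U) (hH : H.IsSemisimple U) {p : Fin n → ℝ}
    (hp : p ∈ U) (μ : ℝ) : ∀ᶠ u in 𝓝 p, (H.metric μ u).IsSymm := by
  filter_upwards [hU.mem_nhds hp] with u hu using hH.metric_isSymm hu μ

lemma partialDeriv_metric_eq (hU : IsOpen U) (hH : H.IsSemisimple U) {p : Fin n → ℝ}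
    (hp : p ∈ U) (μ : ℝ) (i j k : Fin n) : partialDeriv k (fun u => H.metric μ u i j) p
      = partialDeriv k (fun u => H.g₂ u i j) p - μ * partialDeriv k (fun u => H.g₁ u i j) p := by
  have h1 := ((hH.smooth_g₁ i j).contDiffAt (hU.mem_nhds hp)).differentiableAt (by simp)
  have h2 := ((hH.smooth_g₂ i j).contDiffAt (hU.mem_nhds hp)).differentiableAt (by simp)
  have h := (h2.hasFDerivAt.sub (h1.hasFDerivAt.const_mul μ)).fderiv
  simp only [HydroPencil.metric, Matrix.sub_apply, Matrix.smul_apply, smul_eq_mul]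
  exact congrArg (fun L => L (Pi.single k 1)) h

/-- The Christoffel identities are given only where the pencil is nondegenerate, but they are needed
at the roots `μ = p i`. Only finitely many `μ` are excluded, and both sides are continuous in `μ`.
-/
lemma dense_det_metric_ne_zero (hH : H.IsSemisimple U) {p : Fin n → ℝ} (hp : p ∈ U) :
    Dense {μ : ℝ | (H.metric μ p).det ≠ 0} := by
  refine ((Set.finite_range p).countable.dense_compl ℝ).mono fun μ hμ => ?_
  change (H.metric μ p).det ≠ 0
  rw [hH.canonical p hp μ]
  refine mul_ne_zero (hH.det_ne_zero p hp) (Finset.prod_ne_zero_iff.2 fun i _ h => hμ ⟨i, ?_⟩)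
  linarith

lemma pencil_christoffel_add (hU : IsOpen U) (hH : H.IsSemisimple U) {p : Fin n → ℝ}
    (hp : p ∈ U) (μ : ℝ) (i j k : Fin n) :
    (H.Γ₂ i j k p - μ * H.Γ₁ i j k p) + (H.Γ₂ j i k p - μ * H.Γ₁ j i k p)
      = partialDeriv k (fun u => H.metric μ u i j) p := by
  simp only [hH.partialDeriv_metric_eq hU hp]
  refine congrFun (Continuous.ext_on (hH.dense_det_metric_ne_zero hp)
    (f := fun μ => (H.Γ₂ i j k p - μ * H.Γ₁ i j k p) + (H.Γ₂ j i k p - μ * H.Γ₁ j i k p))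
    (g := fun μ => partialDeriv k (fun u => H.g₂ u i j) p
      - μ * partialDeriv k (fun u => H.g₁ u i j) p)
    (by fun_prop) (by fun_prop) fun μ hμ => ?_) μ
  dsimp only
  rw [hH.christoffel_pencil μ p hp hμ, hH.christoffel_pencil μ p hp hμ,
    contraChristoffel_add (hH.metric_differentiableAt hU hp μ)
      (hH.eventually_metric_isSymm hU hp μ) hμ, hH.partialDeriv_metric_eq hU hp]

lemma pencil_christoffel_symm (hU : IsOpen U) (hH : H.IsSemisimple U) {p : Fin n → ℝ}
    (hp : p ∈ U) (μ : ℝ) (i j k : Fin n) :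
    ∑ s, H.metric μ p i s * (H.Γ₂ j k s p - μ * H.Γ₁ j k s p)
      = ∑ s, H.metric μ p j s * (H.Γ₂ i k s p - μ * H.Γ₁ i k s p) := by
  have hc : ∀ a b, Continuous fun μ => H.metric μ p a b := fun a b => by
    simp only [HydroPencil.metric, Matrix.sub_apply, Matrix.smul_apply, smul_eq_mul]
    fun_prop
  refine congrFun (Continuous.ext_on (hH.dense_det_metric_ne_zero hp)
    (f := fun μ => ∑ s, H.metric μ p i s * (H.Γ₂ j k s p - μ * H.Γ₁ j k s p))
    (g := fun μ => ∑ s, H.metric μ p j s * (H.Γ₂ i k s p - μ * H.Γ₁ i k s p))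
    (by fun_prop) (by fun_prop) fun μ hμ => ?_) μ
  dsimp only
  simp only [hH.christoffel_pencil μ p hp hμ]
  exact metric_contraChristoffel_symm (hH.eventually_metric_isSymm hU hp μ) i j k

/-- With `μ` frozen at `p i` the determinant is `(u i - p i) R(u)`; at `p` only the derivative of
the vanishing factor survives. -/
lemma partialDeriv_det_metric (hU : IsOpen U) (hH : H.IsSemisimple U) {p : Fin n → ℝ}
    (hp : p ∈ U) (i s : Fin n) : partialDeriv s (fun u => (H.metric (p i) u).det) p
      = if s = i then (H.g₁ p).det * ∏ j ∈ Finset.univ.erase i, (p j - p i) else 0 := by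
  have hg : ∀ a b, DifferentiableAt ℝ (fun u => H.g₁ u a b) p := fun a b =>
    ((hH.smooth_g₁ a b).contDiffAt (hU.mem_nhds hp)).differentiableAt (by simp)
  set R : (Fin n → ℝ) → ℝ := fun u => (H.g₁ u).det * ∏ j ∈ Finset.univ.erase i, (u j - p i)
  have hR : DifferentiableAt ℝ R p := (hasFDerivAt_det hg).differentiableAt.mul (by fun_prop)
  have hev : (fun u => (H.metric (p i) u).det) =ᶠ[𝓝 p] fun u => (u i - p i) * R u := by
    filter_upwards [hU.mem_nhds hp] with u hu
    rw [hH.canonical u hu, ← Finset.mul_prod_erase _ _ (Finset.mem_univ i)]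
    ring
  have hl : HasFDerivAt (fun u : Fin n → ℝ => u i - p i)
      (ContinuousLinearMap.proj (R := ℝ) (φ := fun _ : Fin n => ℝ) i) p :=
    (ContinuousLinearMap.proj (R := ℝ) (φ := fun _ : Fin n => ℝ) i).hasFDerivAt.sub_const _
  rw [partialDeriv_congr hev, partialDeriv, (hl.fun_mul hR.hasFDerivAt).fderiv]
  simp [Pi.single_apply, R, eq_comm]

lemma metric_col_eq_zero (hU : IsOpen U) (hH : H.IsSemisimple U) {p : Fin n → ℝ}
    (hp : p ∈ U) (i a : Fin n) : H.metric (p i) p a i = 0 := by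
  set G := H.metric (p i) p with hGdef
  set Γ : Fin n → Fin n → Fin n → ℝ := fun a b s => H.Γ₂ a b s p - p i * H.Γ₁ a b s p
  have hdet : G.det = 0 := by
    rw [hGdef, hH.canonical p hp, Finset.prod_eq_zero (Finset.mem_univ i) (sub_self _), mul_zero]
  have hsymm : ∀ a b, G.adjugate a b = G.adjugate b a := fun a b => by
    have : G.adjugate.transpose = G.adjugate := by
      rw [Matrix.adjugate_transpose, (hH.metric_isSymm hp (p i) : G.transpose = G)]
    exact (congrFun (congrFun this b) a)
  -- Jacobi's formula with `∂_s G^{bc} = Γ^{bc}_s + Γ^{cb}_s`; the adjugate is symmetric, so both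
  -- halves agree.
  have hd : ∀ s, partialDeriv s (fun u => (H.metric (p i) u).det) p
      = 2 * ∑ b, ∑ c, G.adjugate c b * Γ b c s := fun s => by
    have h1 : ∑ b, ∑ c, G.adjugate c b * Γ c b s = ∑ b, ∑ c, G.adjugate c b * Γ b c s := by
      rw [Finset.sum_comm]
      exact Finset.sum_congr rfl fun b _ => Finset.sum_congr rfl fun c _ => by rw [hsymm]
    rw [partialDeriv_det (hH.metric_differentiableAt hU hp (p i))]
    simp only [← hH.pencil_christoffel_add hU hp, mul_add, Finset.sum_add_distrib]
    rw [two_mul]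
    exact congrArg₂ (· + ·) rfl h1
  -- The torsion identity moves the contracted `G` onto an index of the adjugate, where `adj G * G =
  -- det G = 0` annihilates it.
  have hker : ∑ s, G a s * ∑ b, ∑ c, G.adjugate c b * Γ b c s = 0 := by
    have h1 : ∀ c, ∑ b, G.adjugate c b * ∑ s, G b s * Γ a c s = 0 := fun c => by
      simp only [Finset.mul_sum]
      rw [Finset.sum_comm]
      refine Finset.sum_eq_zero fun s _ => ?_
      have h2 := congrFun (congrFun (Matrix.adjugate_mul G) c) s
      rw [hdet, zero_smul, Matrix.mul_apply, Matrix.zero_apply] at h2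
      simp only [← mul_assoc, ← Finset.sum_mul, h2, zero_mul]
    calc ∑ s, G a s * ∑ b, ∑ c, G.adjugate c b * Γ b c s
        = ∑ c, ∑ b, G.adjugate c b * ∑ s, G a s * Γ b c s := by
          simp only [Finset.mul_sum]
          rw [Finset.sum_comm]
          refine (Finset.sum_congr rfl fun b _ => Finset.sum_comm).trans ?_
          rw [Finset.sum_comm]
          exact Finset.sum_congr rfl fun c _ => Finset.sum_congr rfl fun b _ =>
            Finset.sum_congr rfl fun s _ => mul_left_comm _ _ _
      _ = ∑ c, ∑ b, G.adjugate c b * ∑ s, G b s * Γ a c s := by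
          refine Finset.sum_congr rfl fun c _ => Finset.sum_congr rfl fun b _ => ?_
          rw [hH.pencil_christoffel_symm hU hp (p i) a b c]
      _ = 0 := Finset.sum_eq_zero fun c _ => h1 c
  -- Distinctness of the coordinates makes `p i` a simple root, so the only nonzero component of `d
  -- (det G)` isolates the entry `G a i`.
  have hc : (H.g₁ p).det * ∏ j ∈ Finset.univ.erase i, (p j - p i) ≠ 0 :=
    mul_ne_zero (hH.det_ne_zero p hp) (Finset.prod_ne_zero_iff.2 fun j hj h =>
      Finset.ne_of_mem_erase hj (hH.distinct p hp (sub_eq_zero.1 h)))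
  have hfin : ∑ s, G a s * partialDeriv s (fun u => (H.metric (p i) u).det) p = 0 := by
    simp only [hd, mul_left_comm _ (2 : ℝ), ← Finset.mul_sum, hker, mul_zero]
  simp only [hH.partialDeriv_det_metric hU hp, mul_ite, mul_zero] at hfin
  rw [Finset.sum_ite_eq' Finset.univ i, if_pos (Finset.mem_univ i)] at hfin
  exact (mul_eq_zero.1 hfin).resolve_right hc

lemma g₂_eq (hU : IsOpen U) (hH : H.IsSemisimple U) {p : Fin n → ℝ} (hp : p ∈ U)
    (a i : Fin n) : H.g₂ p a i = p i * H.g₁ p a i := by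
  have := hH.metric_col_eq_zero hU hp i a
  simp only [HydroPencil.metric, Matrix.sub_apply, Matrix.smul_apply, smul_eq_mul] at this
  linarith

/-- Symmetry of both metrics turns `g₂^{ij} = u^j g₁^{ij}` into `(u^j - u^i) g₁^{ij} = 0`. -/
lemma g₁_offDiag (hU : IsOpen U) (hH : H.IsSemisimple U) {p : Fin n → ℝ} (hp : p ∈ U)
    {i j : Fin n} (hij : i ≠ j) : H.g₁ p i j = 0 := by
  have h1 : H.g₁ p i j = H.g₁ p j i := congrFun (congrFun (hH.symm_g₁ p hp) j) i
  have h2 : H.g₂ p i j = H.g₂ p j i := congrFun (congrFun (hH.symm_g₂ p hp) j) i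
  rw [hH.g₂_eq hU hp, hH.g₂_eq hU hp, ← h1] at h2
  have h3 : p j - p i ≠ 0 := sub_ne_zero.2 fun h => hij (hH.distinct p hp h).symm
  refine (mul_eq_zero.1 (?_ : (p j - p i) * H.g₁ p i j = 0)).resolve_left h3
  linarith

lemma g₁_eq_diagonal (hU : IsOpen U) (hH : H.IsSemisimple U) {p : Fin n → ℝ} (hp : p ∈ U) :
    H.g₁ p = Matrix.diagonal fun i => H.g₁ p i i := by
  ext i j
  by_cases h : i = j
  · subst h; simp
  · rw [Matrix.diagonal_apply_ne _ h, hH.g₁_offDiag hU hp h]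

lemma g₁_diag_ne_zero (hU : IsOpen U) (hH : H.IsSemisimple U) {p : Fin n → ℝ} (hp : p ∈ U)
    (i : Fin n) : H.g₁ p i i ≠ 0 := by
  have h := hH.det_ne_zero p hp
  rw [hH.g₁_eq_diagonal hU hp, Matrix.det_diagonal] at h
  exact Finset.prod_ne_zero_iff.1 h i (Finset.mem_univ i)

lemma metric_eq_diagonal (hU : IsOpen U) (hH : H.IsSemisimple U) {p : Fin n → ℝ} (hp : p ∈ U)
    (μ : ℝ) : H.metric μ p = Matrix.diagonal fun i => (p i - μ) * H.g₁ p i i := by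
  ext i j
  simp only [HydroPencil.metric, Matrix.sub_apply, Matrix.smul_apply, smul_eq_mul,
    hH.g₂_eq hU hp]
  by_cases h : i = j
  · subst h; simp; ring
  · rw [Matrix.diagonal_apply_ne _ h, hH.g₁_offDiag hU hp h]; ring

end HydroPencil.IsSemisimple

/-! ### The unit vector field of an exact pencil -/

lemma hasOrder_lift (f : (Fin n → ℝ) → ℝ) : HasOrder (U := U) 0 (lift f) := fun J J' h => by
  simp [lift, h 0 le_rfl]

lemma hydroBivector_coeff_one (g : (Fin n → ℝ) → Matrix (Fin n) (Fin n) ℝ)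
    (Γ : Fin n → Fin n → Fin n → (Fin n → ℝ) → ℝ) (i j : Fin n) :
    (hydroBivector g Γ : Bivector U) i j 1 = lift fun u => g u i j := by
  simp [hydroBivector]

lemma hydroBivector_coeff_of_gt (g : (Fin n → ℝ) → Matrix (Fin n) (Fin n) ℝ)
    (Γ : Fin n → Fin n → Fin n → (Fin n → ℝ) → ℝ) (i j : Fin n) {a : ℕ} (ha : 1 < a) :
    (hydroBivector g Γ : Bivector U) i j a = 0 := by
  have h0 : (0 : ℕ) ≠ a := by omega
  have h1 : (1 : ℕ) ≠ a := by omega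
  simp [hydroBivector, h0, h1]

lemma prolong_jet_mul (hU : IsOpen U) (X : VField U) (i : Fin n) {F : DiffFun U}
    (hF : F ∈ smoothAlg hU) (h0 : HasOrder 0 F) :
    prolong X (jet 0 i * F) = X i * F + jet 0 i * prolong X F := by
  have hjF : HasOrder 0 (jet 0 i * F) := (hasOrder_jet 0 i).comp₂ h0 (· * ·)
  rw [hjF.prolong_eq hU, h0.prolong_eq hU]
  simp only [zero_add, Finset.sum_range_one, Function.iterate_zero, id_eq]
  have hk : ∀ k, X k * pd 0 k (jet 0 i * F)
      = (if i = k then X k * F else 0) + jet 0 i * (X k * pd 0 k F) := fun k => by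
    rw [pd_mul (jet_mem 0 i) hF, pd_jet hU]
    by_cases h : i = k
    · subst h
      funext J
      simp
      ring
    · funext J
      simp [h]
      ring
  simp only [hk, Finset.sum_add_distrib, Finset.sum_ite_eq, Finset.mem_univ, if_true,
    ← Finset.mul_sum]

variable {H : HydroPencil n}

lemma HydroPencil.IsSemisimple.f_mem (hH : H.IsSemisimple U) (i : Fin n) :
    H.f i ∈ smoothAlg hU := isSmooth_lift hU (hH.smooth_g₁ i i)

lemma HydroPencil.IsSemisimple.f_ne_zero (hU : IsOpen U) (hH : H.IsSemisimple U) (i : Fin n)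
    (J : Jet U) : H.f i J ≠ 0 := hH.g₁_diag_ne_zero hU J.2 i

lemma HydroPencil.IsSemisimple.lift_g₁ (hU : IsOpen U) (hH : H.IsSemisimple U) (i j : Fin n) :
    (lift fun u => H.g₁ u i j : DiffFun U) = if i = j then H.f i else 0 := by
  funext J
  by_cases h : i = j
  · subst h
    simp [HydroPencil.f]
  · simp [h, lift, hH.g₁_offDiag hU J.2 h]

lemma HydroPencil.IsSemisimple.lift_g₂ (hU : IsOpen U) (hH : H.IsSemisimple U) (i j : Fin n) :
    (lift fun u => H.g₂ u i j : DiffFun U) = if i = j then jet 0 i * H.f i else 0 := by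
  funext J
  by_cases h : i = j
  · subst h
    simp [HydroPencil.f, lift, jet, hH.g₂_eq hU J.2]
  · simp [h, lift, hH.g₂_eq hU J.2, hH.g₁_offDiag hU J.2 h]

/-- In canonical coordinates the vector field of an exact pencil is `∑_k ∂/∂u^k`. -/
lemma HydroPencil.IsExactFor.eq_one (hU : IsOpen U) (hH : H.IsSemisimple U)
    {e : (Fin n → ℝ) → Fin n → ℝ} (he : H.IsExactFor U e) (u : Fin n → ℝ) (hu : u ∈ U)
    (i : Fin n) : e u i = 1 := by
  have hX : ∀ i, HasOrder (U := U) 0 (liftVec e i) := fun i => hasOrder_lift _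
  -- The index is written `0 + 1` to match `lieDeriv_coeff_top` for a field of order zero.
  have h1 := congrArg (fun P : Bivector U => P i i (0 + 1)) he.lie_ω₁
  have h2 := congrArg (fun P : Bivector U => P i i (0 + 1)) he.lie_ω₂
  replace h1 := (lieDeriv_coeff_top hU hX (P := H.ω₁)
    (fun i j a ha => hydroBivector_coeff_of_gt _ _ i j ha) i i).symm.trans h1
  replace h2 := (lieDeriv_coeff_top hU hX (P := H.ω₂)
    (fun i j a ha => hydroBivector_coeff_of_gt _ _ i j ha) i i).symm.trans h2
  simp only [HydroPencil.ω₁, HydroPencil.ω₂, zero_add, hydroBivector_coeff_one,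
    hH.lift_g₁ hU, hH.lift_g₂ hU, mul_ite, ite_mul, mul_zero, zero_mul, Finset.sum_ite_eq,
    Finset.sum_ite_eq', Finset.mem_univ, if_true, pow_zero, one_mul] at h1 h2
  rw [prolong_jet_mul hU _ i (hH.f_mem i) (hasOrder_lift _)] at h2
  set J : Jet U := constJet ⟨u, hu⟩
  have h1' := congrFun h1 J
  have h2' := congrFun h2 J
  have hf := hH.f_ne_zero hU i J
  have he : (liftVec e i : DiffFun U) J = e u i := by simp [liftVec, lift, J, constJet]
  simp only [Pi.sub_apply, Pi.mul_apply, Pi.add_apply, Pi.zero_apply, Finsupp.zero_apply,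
    he] at h1' h2'
  -- The second equation minus `u^i` times the first: the derivatives of `f^i` and of `e^i` cancel,
  -- and only the derivative of the factor `u^i` in `g₂^{ii}` remains.
  have h3 : e u i * H.f i J = 1 * H.f i J := by linear_combination h2' - jet 0 i J * h1'
  exact mul_right_cancel₀ hf h3

/-! ### Differential functions invariant under diagonal translations -/

/-- The smooth differential functions annihilated by the diagonal derivative. -/
def invariantAlg (hU : IsOpen U) : Subalgebra ℝ (DiffFun U) where
  carrier := {F | F ∈ smoothAlg hU ∧ diagDeriv F = 0}
  mul_mem' hF hG := ⟨mul_mem hF.1 hG.1, by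
    rw [diagDeriv_mul hF.1 hG.1, hF.2, hG.2, zero_mul, mul_zero, add_zero]⟩
  add_mem' hF hG := ⟨add_mem hF.1 hG.1, by
    rw [diagDeriv_add hF.1 hG.1, hF.2, hG.2, add_zero]⟩
  algebraMap_mem' a := ⟨isSmooth_const hU a, diagDeriv_const hU a⟩

lemma const_mem_invariantAlg (a : ℝ) : (fun _ => a) ∈ invariantAlg hU :=
  (invariantAlg hU).algebraMap_mem a

lemma pd_mem_invariantAlg {F : DiffFun U} (hF : F ∈ invariantAlg hU) (s : ℕ) (i : Fin n) :
    pd s i F ∈ invariantAlg hU :=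
  ⟨pd_mem hF.1 s i, by rw [diagDeriv_pd hF.1, hF.2, pd_zero]⟩

lemma dx_mem_invariantAlg {F : DiffFun U} (hF : F ∈ invariantAlg hU) :
    dx F ∈ invariantAlg hU :=
  ⟨dx_mem hF.1, by rw [diagDeriv_dx hF.1, hF.2]; exact dx_const hU 0⟩

lemma inv_mem_invariantAlg {F : DiffFun U} (hF : F ∈ invariantAlg hU) (h0 : ∀ J, F J ≠ 0) :
    F⁻¹ ∈ invariantAlg hU :=
  ⟨IsSmooth.inv hF.1 h0, diagDeriv_inv hF.1 h0 hF.2⟩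

lemma jet_mem_invariantAlg (s : ℕ) (i : Fin n) : jet (s + 1) i ∈ invariantAlg hU :=
  ⟨jet_mem _ _, diagDeriv_jet_succ hU s i⟩

/-- A single coordinate is not invariant, but the standard form contains `u^i` only through these
differences, in `L^{ij}`. -/
lemma jet_sub_mem_invariantAlg (i j : Fin n) : jet 0 i - jet 0 j ∈ invariantAlg hU :=
  ⟨sub_mem (jet_mem 0 i) (jet_mem 0 j), by
    rw [diagDeriv_sub (jet_mem (hU := hU) 0 i) (jet_mem 0 j), diagDeriv_jet_zero hU,
      diagDeriv_jet_zero hU, sub_self]⟩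

/-! ### The vector field of the standard form -/

/-- The differential function `c^j(u^j) u^j_x`. -/
def paramJet (c : Fin n → ℝ → ℝ) (j : Fin n) : DiffFun U :=
  (lift fun u => c j (u j)) * jet 1 j

/-- The coefficient of `c^j u^j_x` in the standard form. -/
def HydroPencil.coeffC (H : HydroPencil n) (i j : Fin n) : DiffFun U := fun J =>
  1 / 2 * (if i = j then dx (H.f i) J else 0) + H.coeffA i j J

/-- The coefficient of `∂_x (c^j u^j_x)` in the standard form. -/
def HydroPencil.coeffB (H : HydroPencil n) (i j : Fin n) : DiffFun U := fun J =>
  2 * (if i = j then H.f i J else 0) - H.coeffL i j J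

lemma HydroPencil.fieldX_eq (H : HydroPencil n) (c : Fin n → ℝ → ℝ) (i : Fin n) :
    (H.fieldX c i : DiffFun U)
      = ∑ j, (H.coeffC i j * paramJet c j + H.coeffB i j * dx (paramJet c j)) := rfl

lemma HydroPencil.coeffC_mem (hH : H.IsSemisimple U) (hf : ∀ i, H.f i ∈ invariantAlg hU)
    (i j : Fin n) : (H.coeffC i j : DiffFun U) ∈ invariantAlg hU := by
  have e : (H.coeffC i j : DiffFun U) = (fun _ => 1 / 2) * (if i = j then dx (H.f i) else 0)
      + (fun _ => 1 / 2) * (H.f i * (H.f j)⁻¹ * pd 0 i (H.f j) * jet 1 j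
        - H.f j * (H.f i)⁻¹ * pd 0 j (H.f i) * jet 1 i) := by
    funext J
    by_cases h : i = j <;> simp [HydroPencil.coeffC, HydroPencil.coeffA, h, div_eq_mul_inv]
  rw [e]
  have hinv : ∀ k, (H.f k)⁻¹ ∈ invariantAlg hU := fun k =>
    inv_mem_invariantAlg (hf k) (hH.f_ne_zero hU k)
  refine add_mem (mul_mem (const_mem_invariantAlg _) ?_) (mul_mem (const_mem_invariantAlg _)
    (sub_mem (mul_mem (mul_mem (mul_mem (hf i) (hinv j)) (pd_mem_invariantAlg (hf j) 0 i))
      (jet_mem_invariantAlg 0 j)) (mul_mem (mul_mem (mul_mem (hf j) (hinv i))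
        (pd_mem_invariantAlg (hf i) 0 j)) (jet_mem_invariantAlg 0 i))))
  split_ifs
  · exact dx_mem_invariantAlg (hf i)
  · exact zero_mem _

lemma HydroPencil.coeffB_eq (H : HydroPencil n) (i j : Fin n) :
    (H.coeffB i j : DiffFun U) = (fun _ => 3 / 2) * (if i = j then H.f i else 0)
      - (fun _ => 1 / 2) * ((jet 0 i - jet 0 j) * H.f i * (H.f j)⁻¹ * pd 0 i (H.f j)) := by
  funext J
  by_cases h : i = j
  · subst h
    simp [HydroPencil.coeffB, HydroPencil.coeffL]
    ring
  · simp [HydroPencil.coeffB, HydroPencil.coeffL, h, div_eq_mul_inv]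
    ring

lemma HydroPencil.coeffB_self (H : HydroPencil n) (i : Fin n) :
    (H.coeffB i i : DiffFun U) = (fun _ => 3 / 2) * H.f i := by
  rw [H.coeffB_eq, if_pos rfl, sub_self]
  simp

lemma HydroPencil.coeffB_mem (hH : H.IsSemisimple U) (hf : ∀ i, H.f i ∈ invariantAlg hU)
    (i j : Fin n) : (H.coeffB i j : DiffFun U) ∈ invariantAlg hU := by
  rw [H.coeffB_eq]
  refine sub_mem (mul_mem (const_mem_invariantAlg _) ?_) (mul_mem (const_mem_invariantAlg _)
    (mul_mem (mul_mem (mul_mem (jet_sub_mem_invariantAlg i j) (hf i))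
      (inv_mem_invariantAlg (hf j) (hH.f_ne_zero hU j))) (pd_mem_invariantAlg (hf j) 0 i)))
  split_ifs
  · exact hf i
  · exact zero_mem _

lemma HydroPencil.hasOrder_f (H : HydroPencil n) (i : Fin n) :
    HasOrder (U := U) 0 (H.f i) := hasOrder_lift _

lemma HydroPencil.hasOrder_coeffC (hU : IsOpen U) (H : HydroPencil n) (i j : Fin n) :
    HasOrder (U := U) 1 (H.coeffC i j) := fun J J' h => by
  have h0 : ∀ s ≤ 0, J.1 s = J'.1 s := fun s hs => h s (by omega)
  simp only [HydroPencil.coeffC, HydroPencil.coeffA, H.hasOrder_f i J J' h0,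
    H.hasOrder_f j J J' h0, (H.hasOrder_f i).pd 0 j J J' h0, (H.hasOrder_f j).pd 0 i J J' h0,
    (H.hasOrder_f i).dx hU J J' h, hasOrder_jet 1 i J J' h, hasOrder_jet 1 j J J' h]

lemma HydroPencil.hasOrder_coeffB (H : HydroPencil n) (i j : Fin n) :
    HasOrder (U := U) 0 (H.coeffB i j) := fun J J' h => by
  simp only [HydroPencil.coeffB, HydroPencil.coeffL, H.hasOrder_f i J J' h,
    H.hasOrder_f j J J' h, (H.hasOrder_f j).pd 0 i J J' h, hasOrder_jet 0 i J J' h,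
    hasOrder_jet 0 j J J' h]

section Parameters

variable {c : Fin n → ℝ → ℝ} (hc : ∀ i, ContDiffOn ℝ ∞ (c i) ((fun u : Fin n → ℝ => u i) '' U))
include hc

lemma contDiffOn_deriv_param (hU : IsOpen U) (i : Fin n) :
    ContDiffOn ℝ ∞ (deriv (c i)) ((fun u : Fin n → ℝ => u i) '' U) :=
  (hc i).deriv_of_isOpen (isOpenMap_eval i U hU) le_rfl

lemma lift_param_mem (j : Fin n) :
    (lift fun u => c j (u j) : DiffFun U) ∈ smoothAlg hU :=
  isSmooth_lift hU ((hc j).comp (contDiff_apply ℝ ℝ j).contDiffOn fun u hu => ⟨u, hu, rfl⟩)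

lemma paramJet_mem (j : Fin n) : (paramJet c j : DiffFun U) ∈ smoothAlg hU :=
  mul_mem (lift_param_mem hc j) (jet_mem 1 j)

end Parameters

lemma hasOrder_paramJet (c : Fin n → ℝ → ℝ) (j : Fin n) :
    HasOrder (U := U) 1 (paramJet c j) :=
  ((hasOrder_lift _).mono zero_le_one).comp₂ (hasOrder_jet 1 j) (· * ·)

/-- No smoothness is required: the shift in `u^j` is a translation of the argument, so both sides
are the same `deriv`. -/
lemma diagDeriv_lift_param (hU : IsOpen U) (c : Fin n → ℝ → ℝ) (j : Fin n) :
    diagDeriv (lift fun u => c j (u j) : DiffFun U) = lift fun u => deriv (c j) (u j) := by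
  funext J
  have hk : ∀ k, pd 0 k (lift fun u => c j (u j) : DiffFun U) J
      = if j = k then deriv (c j) (J.1 0 j) else 0 := fun k => by
    rw [pd_eq_deriv hU 0 k _ J (fun t => c j (J.1 0 j + if j = k then t else 0))]
    · by_cases h : j = k
      · simp [h, deriv_comp_const_add]
      · simp [h]
    · intro t ht
      simp [lift, shift_apply]
  simp [diagDeriv, hk, lift]

/-- `dx F` is affine in the jets of order `N + 1`, with the top partial derivatives of `F` as
coefficients. -/
lemma HasOrder.pd_succ_dx {N : ℕ} {F : DiffFun U} (h : HasOrder N F) (hF : F ∈ smoothAlg hU)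
    (k : Fin n) : LoopSpace.pd (N + 1) k (LoopSpace.dx F) = LoopSpace.pd N k F := by
  have hm : ∀ s i, jet (s + 1) i * LoopSpace.pd s i F ∈ smoothAlg hU := fun s i =>
    mul_mem (jet_mem _ _) (pd_mem hF s i)
  have hp : ∀ s i, LoopSpace.pd (N + 1) k (jet (s + 1) i * LoopSpace.pd s i F)
      = if s = N ∧ i = k then LoopSpace.pd N k F else 0 := fun s i => by
    rw [pd_mul (jet_mem _ _) (pd_mem hF s i), (h.pd s i).pd_eq_zero hU (Nat.lt_succ_self N),
      mul_zero, add_zero, pd_jet hU]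
    by_cases hs : s = N ∧ i = k
    · rw [if_pos hs, hs.1, hs.2]
      funext J
      simp
    · rw [if_neg hs]
      funext J
      simp [hs]
  rw [h.dx_eq hU, pd_sum (hU := hU) fun s _ => sum_mem fun i _ => hm s i]
  rw [Finset.sum_eq_single N]
  · rw [pd_sum (hU := hU) fun i _ => hm N i]
    simp [hp]
  · intro s _ hs
    rw [pd_sum (hU := hU) fun i _ => hm s i]
    simp [hp, hs]
  · simp

section Parameters

variable {c : Fin n → ℝ → ℝ} (hc : ∀ i, ContDiffOn ℝ ∞ (c i) ((fun u : Fin n → ℝ => u i) '' U))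
include hc

lemma diagDeriv_paramJet (hU : IsOpen U) (j : Fin n) :
    diagDeriv (paramJet c j : DiffFun U) = paramJet (fun j => deriv (c j)) j := by
  rw [paramJet, diagDeriv_mul (lift_param_mem (hU := hU) hc j) (jet_mem 1 j),
    diagDeriv_jet_succ hU, mul_zero, add_zero, diagDeriv_lift_param hU]
  rfl

lemma pd_two_dx_paramJet (hU : IsOpen U) (j k : Fin n) :
    pd 2 k (dx (paramJet c j) : DiffFun U) = if j = k then lift fun u => c j (u j) else 0 := by
  rw [(hasOrder_paramJet c j).pd_succ_dx (paramJet_mem (hU := hU) hc j), paramJet,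
    pd_mul (lift_param_mem (hU := hU) hc j) (jet_mem 1 j),
    (hasOrder_lift _).pd_eq_zero hU zero_lt_one, zero_mul, zero_add, pd_jet hU]
  funext J
  by_cases h : j = k <;> simp [h]

lemma HydroPencil.fieldX_mem (hH : H.IsSemisimple U) (hf : ∀ i, H.f i ∈ invariantAlg hU)
    (i : Fin n) : (H.fieldX c i : DiffFun U) ∈ smoothAlg hU := by
  rw [H.fieldX_eq]
  exact sum_mem fun j _ => add_mem (mul_mem (H.coeffC_mem hH hf i j).1 (paramJet_mem hc j))
    (mul_mem (H.coeffB_mem hH hf i j).1 (dx_mem (paramJet_mem hc j)))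

/-- `[e, X_c] = X_{c'}`: the coefficients are invariant, so the derivative falls on the parameters
alone. -/
lemma HydroPencil.diagDeriv_fieldX (hH : H.IsSemisimple U)
    (hf : ∀ i, H.f i ∈ invariantAlg hU) (i : Fin n) :
    diagDeriv (H.fieldX c i : DiffFun U) = H.fieldX (fun j => deriv (c j)) i := by
  have hC := fun j => H.coeffC_mem hH hf i j
  have hB := fun j => H.coeffB_mem hH hf i j
  have hW := fun j => paramJet_mem (hU := hU) hc j
  rw [H.fieldX_eq, H.fieldX_eq, diagDeriv_sum (hU := hU) fun j _ => add_mem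
    (mul_mem (hC j).1 (hW j)) (mul_mem (hB j).1 (dx_mem (hW j)))]
  refine Finset.sum_congr rfl fun j _ => ?_
  rw [diagDeriv_add (mul_mem (hC j).1 (hW j)) (mul_mem (hB j).1 (dx_mem (hW j))),
    diagDeriv_mul (hC j).1 (hW j), diagDeriv_mul (hB j).1 (dx_mem (hW j)), (hC j).2, (hB j).2,
    diagDeriv_dx (hW j), diagDeriv_paramJet hc hU, zero_mul, zero_mul, zero_add, zero_add]

lemma HydroPencil.pd_two_fieldX (hH : H.IsSemisimple U)
    (hf : ∀ i, H.f i ∈ invariantAlg hU) (i k : Fin n) :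
    pd 2 k (H.fieldX c i : DiffFun U) = H.coeffB i k * lift fun u => c k (u k) := by
  have hC := fun j => H.coeffC_mem hH hf i j
  have hB := fun j => H.coeffB_mem hH hf i j
  have hW := fun j => paramJet_mem (hU := hU) hc j
  rw [H.fieldX_eq, pd_sum (hU := hU) fun j _ => add_mem
    (mul_mem (hC j).1 (hW j)) (mul_mem (hB j).1 (dx_mem (hW j)))]
  have hj : ∀ j, pd 2 k (H.coeffC i j * paramJet c j + H.coeffB i j * dx (paramJet c j))
      = if j = k then H.coeffB i k * (lift fun u => c k (u k)) else (0 : DiffFun U) := fun j => by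
    rw [pd_add (mul_mem (hC j).1 (hW j)) (mul_mem (hB j).1 (dx_mem (hW j))),
      pd_mul (hC j).1 (hW j), pd_mul (hB j).1 (dx_mem (hW j)),
      (H.hasOrder_coeffC hU i j).pd_eq_zero hU (by omega),
      (hasOrder_paramJet c j).pd_eq_zero hU (by omega),
      (H.hasOrder_coeffB i j).pd_eq_zero hU (by omega), pd_two_dx_paramJet hc hU]
    by_cases h : j = k
    · subst h
      simp
    · simp [h]
  simp [hj]

end Parameters

lemma HydroPencil.hasOrder_fieldX (hU : IsOpen U) (H : HydroPencil n) (c : Fin n → ℝ → ℝ)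
    (i : Fin n) : HasOrder (U := U) 2 (H.fieldX c i) := by
  rw [H.fieldX_eq]
  refine HasOrder.sum fun j _ => HasOrder.comp₂ ?_ ?_ (· + ·)
  · exact (((H.hasOrder_coeffC hU i j).comp₂ (hasOrder_paramJet c j) (· * ·)).mono
      one_le_two : HasOrder 2 (H.coeffC i j * paramJet c j))
  · exact (((H.hasOrder_coeffB i j).mono (Nat.zero_le 2)).comp₂
      ((hasOrder_paramJet c j).dx hU) (· * ·) : HasOrder 2 (H.coeffB i j * dx (paramJet c j)))

/-- The fields depend only on the values of the parameters on the projections of `U`. -/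
lemma HydroPencil.fieldX_congr (H : HydroPencil n) {c c' : Fin n → ℝ → ℝ}
    (h : ∀ u ∈ U, ∀ j, c j (u j) = c' j (u j)) :
    (H.fieldX c : VField U) = H.fieldX c' := by
  have hW : ∀ j, (paramJet c j : DiffFun U) = paramJet c' j := fun j => by
    funext J
    simp [paramJet, lift, h _ J.2 j]
  funext i
  simp only [H.fieldX_eq, hW]

lemma HydroPencil.fieldX_zero (hU : IsOpen U) (H : HydroPencil n) :
    (H.fieldX (fun _ _ => 0) : VField U) = 0 := by
  have hW : ∀ j, (paramJet (fun _ _ => 0) j : DiffFun U) = 0 := fun j => by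
    funext J
    simp [paramJet, lift]
  have h0 : dx (0 : DiffFun U) = 0 := dx_const hU 0
  funext i
  simp [H.fieldX_eq, hW, h0]

/-! ### The bivectors in standard form -/

/-- The coefficient of `δ'''` on the diagonal of `Lie_{X_c} ω₁`. -/
lemma HydroPencil.lieDeriv_fieldX_coeff_three (hH : H.IsSemisimple U)
    (hf : ∀ i, H.f i ∈ invariantAlg hU) {c : Fin n → ℝ → ℝ}
    (hc : ∀ i, ContDiffOn ℝ ∞ (c i) ((fun u : Fin n → ℝ => u i) '' U)) (i : Fin n)
    (J : Jet U) :
    lieDeriv (H.fieldX c) H.ω₁ i i 3 J = -3 * H.f i J ^ 2 * c i (J.1 0 i) := by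
  have h3 : (H.ω₁ : Bivector U) i i 3 = 0 :=
    hydroBivector_coeff_of_gt _ _ i i (by omega)
  refine (congrFun (lieDeriv_coeff_top (A := 2) hU (H.hasOrder_fieldX hU c) (P := H.ω₁)
    (fun i j a ha => hydroBivector_coeff_of_gt _ _ i j ha) i i) J).trans ?_
  rw [h3, prolong_zero]
  -- Since `ω₁` has diagonal leading part, only `k = i` contributes. Each sum gives `(3/2) f² c`,
  -- and the adjoint sign `(-1)²` is positive, so they add up to the factor `-3`.
  simp only [HydroPencil.ω₁, hydroBivector_coeff_one, hH.lift_g₁ hU, H.pd_two_fieldX hc hH hf,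
    mul_ite, ite_mul, mul_zero, zero_mul, Finset.sum_ite_eq, Finset.sum_ite_eq',
    Finset.mem_univ, if_true, H.coeffB_self]
  simp [lift]
  ring

lemma HydroPencil.IsSemisimple.ω₁_mem (hH : H.IsSemisimple U) (i j : Fin n) (a : ℕ) :
    (H.ω₁ : Bivector U) i j a ∈ smoothAlg hU := by
  rw [HydroPencil.ω₁, hydroBivector, Finsupp.add_apply, Finsupp.single_apply,
    Finsupp.single_apply]
  refine add_mem ?_ ?_
  · split_ifs
    · exact isSmooth_lift hU (hH.smooth_g₁ i j)
    · exact zero_mem _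
  · split_ifs
    · exact sum_mem fun k _ => mul_mem (isSmooth_lift hU (hH.smooth_Γ₁ i j k)) (jet_mem 1 k)
    · exact zero_mem _

lemma HydroPencil.f_mem_invariantAlg (hH : H.IsSemisimple U)
    (hω : diagDerivBi (H.ω₁ : Bivector U) = 0) (i : Fin n) : H.f i ∈ invariantAlg hU := by
  refine ⟨hH.f_mem i, ?_⟩
  have h := congrArg (fun P : Bivector U => P i i 1) hω
  simpa [diagDerivBi, HydroPencil.ω₁, hydroBivector_coeff_one, hH.lift_g₁ hU] using h

/-- Each step replaces `c` by its derivative, because `Lie_e ω₁ = 0` removes the other term of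
`diagDerivBi_lieDeriv`. -/
lemma HydroPencil.iterate_diagDerivBi (hU : IsOpen U) (hH : H.IsSemisimple U)
    (hω : diagDerivBi (H.ω₁ : Bivector U) = 0) {c : Fin n → ℝ → ℝ}
    (hc : ∀ i, ContDiffOn ℝ ∞ (c i) ((fun u : Fin n → ℝ => u i) '' U)) (m : ℕ) :
    diagDerivBi^[m] (lieDeriv (H.fieldX c) H.ω₁ : Bivector U)
      = lieDeriv (H.fieldX fun j => deriv^[m] (c j)) H.ω₁ := by
  have hf := fun i => H.f_mem_invariantAlg (hU := hU) hH hω i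
  induction m generalizing c with
  | zero => rfl
  | succ m ih =>
    have h1 : (fun i => diagDeriv (H.fieldX c i) : VField U)
        = H.fieldX fun j => deriv (c j) := funext fun i => H.diagDeriv_fieldX hc hH hf i
    rw [Function.iterate_succ_apply, diagDerivBi_lieDeriv (H.fieldX_mem hc hH hf)
      (hH.ω₁_mem (hU := hU)), hω, lieDeriv_zero_right, add_zero, h1,
      ih fun i => contDiffOn_deriv_param hc hU i]
    rfl

/-! ### Functions with a vanishing iterated derivative -/

lemma exists_derivative_eq (m : ℕ) {q : Polynomial ℝ} (hq : q.degree < m) :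
    ∃ P : Polynomial ℝ, P.degree < (m + 1 : ℕ) ∧ P.derivative = q := by
  refine ⟨∑ k ∈ Finset.range m, Polynomial.monomial (k + 1) (q.coeff k / (k + 1)), ?_, ?_⟩
  · rw [← Polynomial.mem_degreeLT]
    refine Submodule.sum_mem _ fun k hk => Polynomial.mem_degreeLT.2 ?_
    refine (Polynomial.degree_monomial_le _ _).trans_lt ?_
    have := Finset.mem_range.1 hk
    exact_mod_cast Nat.succ_lt_succ this
  · have hk : ∀ k : ℕ, (Polynomial.monomial (k + 1) (q.coeff k / (k + 1))).derivative
        = Polynomial.monomial k (q.coeff k) := fun k => by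
      rw [Polynomial.derivative_monomial, Nat.add_sub_cancel]
      congr 1
      push_cast
      field_simp
    ext d
    simp only [Polynomial.derivative_sum, hk, Polynomial.finsetSum_coeff,
      Polynomial.coeff_monomial, Finset.sum_ite_eq', Finset.mem_range]
    split_ifs with h
    · rfl
    · exact (Polynomial.coeff_eq_zero_of_degree_lt
        (hq.trans_le (by exact_mod_cast not_lt.1 h))).symm

/-- Integrate once per step; connectedness makes the integration constant the same on all of `I`. -/
lemma exists_polynomial_of_iterate_deriv_eq_zero {I : Set ℝ} (hI : IsOpen I)
    (hconn : IsPreconnected I) (m : ℕ) {f : ℝ → ℝ} (hf : ContDiffOn ℝ ∞ f I)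
    (h : ∀ x ∈ I, deriv^[m] f x = 0) :
    ∃ p : Polynomial ℝ, p.degree < m ∧ ∀ x ∈ I, f x = p.eval x := by
  induction m generalizing f with
  | zero => exact ⟨0, by simp, fun x hx => by simpa using h x hx⟩
  | succ m ih =>
    obtain ⟨q, hq, hfq⟩ := ih (hf.deriv_of_isOpen hI le_rfl) h
    obtain ⟨P, hP, rfl⟩ := exists_derivative_eq m hq
    have hd : ∀ x ∈ I, HasDerivAt f (P.derivative.eval x) x := fun x hx => by
      rw [← hfq x hx]
      exact ((hf.contDiffAt (hI.mem_nhds hx)).differentiableAt (by simp)).hasDerivAt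
    obtain ⟨a, ha⟩ := hI.exists_is_const_of_deriv_eq_zero hconn
      (f := fun x => f x - P.eval x)
      (fun x hx => ((hd x hx).sub (P.hasDerivAt x)).differentiableAt.differentiableWithinAt)
      (fun x hx => by simpa using ((hd x hx).fun_sub (P.hasDerivAt x)).deriv)
    refine ⟨P + Polynomial.C a, ?_, fun x hx => ?_⟩
    · refine (Polynomial.degree_add_le _ _).trans_lt (max_lt hP ?_)
      exact Polynomial.degree_C_le.trans_lt (by exact_mod_cast Nat.succ_pos m)
    · have := ha x hx
      simp only [Polynomial.eval_add, Polynomial.eval_C]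
      linarith

lemma iterate_deriv_eq_eval {I : Set ℝ} (hI : IsOpen I) {f : ℝ → ℝ} {p : Polynomial ℝ}
    (h : ∀ x ∈ I, f x = p.eval x) (m : ℕ) :
    ∀ x ∈ I, deriv^[m] f x = (Polynomial.derivative^[m] p).eval x := by
  induction m generalizing f p with
  | zero => exact h
  | succ m ih =>
    refine ih (f := deriv f) (p := p.derivative) fun x hx => ?_
    have h' : Set.EqOn f (fun x => p.eval x) I := h
    rw [h'.deriv hI hx, Polynomial.deriv]

/-- The `l`-th derivative is the constant `l!` times the leading coefficient. -/
lemma eval_iterate_derivative_ne_zero {p : Polynomial ℝ} {l : ℕ} (h : p.degree = l) (x : ℝ) :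
    (Polynomial.derivative^[l] p).eval x ≠ 0 := by
  have hn : p.natDegree = l := Polynomial.natDegree_eq_of_degree_eq_some h
  have h0 : (Polynomial.derivative^[l] p).natDegree = 0 := by
    have := Polynomial.natDegree_iterate_derivative p l
    omega
  have hc : p.coeff l ≠ 0 := Polynomial.coeff_ne_zero_of_eq_degree h
  rw [Polynomial.eq_C_of_natDegree_eq_zero h0, Polynomial.eval_C,
    Polynomial.coeff_iterate_derivative, zero_add, Nat.descFactorial_self, nsmul_eq_mul]
  exact mul_ne_zero (by exact_mod_cast Nat.factorial_ne_zero l) hc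

/-! ### Central invariants of the standard form -/

section Standard

variable {Q : Pencil U} {c : Fin n → ℝ → ℝ}

/-- The `ε` term vanishes and `ω₁` is undeformed, so the diagonal of `A_μ` is `-3 (f^k)² c^k` for
every `μ`. The trace then has simple poles with explicit residues. -/
lemma Pencil.centralInvariant_eq (hU : IsOpen U) (hH : H.IsSemisimple U)
    (hω : diagDerivBi (H.ω₁ : Bivector U) = 0) (hred : Q.IsReduced H)
    (hstd : Q.IsStandardForm H c) (u : U) (i : Fin n) :
    Q.centralInvariant H u i = - c i (u.1 i) := by
  set f : Fin n → ℝ := fun k => H.g₁ u.1 k k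
  have hf : ∀ k, f k ≠ 0 := hH.g₁_diag_ne_zero hU u.2
  have hinv : ∀ k, H.f k ∈ invariantAlg hU := fun k => H.f_mem_invariantAlg hH hω k
  have hlead1 : ∀ μ, Q.leading μ 1 u = 0 := fun μ => by
    ext a b
    simp [Pencil.leading, Pencil.term, hred.undeformed₁ 1 le_rfl, hred.even₂ 1 odd_one]
  have hA : ∀ μ k, Q.tensorA H μ u k k = -3 * f k ^ 2 * c k (u.1 k) := fun μ k => by
    have h3 := H.lieDeriv_fieldX_coeff_three hH hinv hstd.smooth k (constJet u)
    simp only [Pencil.tensorA, hlead1, Matrix.mul_zero, add_zero]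
    simp only [Pencil.leading, Pencil.term, hred.undeformed₁ 2 one_le_two, hstd.eq_lie,
      Matrix.of_apply, Pi.zero_apply, smul_zero, sub_zero]
    simpa [HydroPencil.f, lift, constJet, f] using h3
  have htr : ∀ μ, (∀ k, u.1 k - μ ≠ 0) → ((H.metric μ u)⁻¹ * Q.tensorA H μ u).trace
      = ∑ k, ((u.1 k - μ) * f k)⁻¹ * (-3 * f k ^ 2 * c k (u.1 k)) := fun μ hμ => by
    have hdiag : (H.metric μ u)⁻¹ = Matrix.diagonal fun k => ((u.1 k - μ) * f k)⁻¹ := by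
      rw [hH.metric_eq_diagonal hU u.2]
      refine Matrix.inv_eq_right_inv ?_
      rw [Matrix.diagonal_mul_diagonal, ← Matrix.diagonal_one]
      congr 1
      funext k
      exact mul_inv_cancel₀ (mul_ne_zero (hμ k) (hf k))
    rw [hdiag, Matrix.trace]
    refine Finset.sum_congr rfl fun k _ => ?_
    rw [Matrix.diag_apply, Matrix.diagonal_mul, hA]
  have hne : ∀ k, k ≠ i → u.1 k - u.1 i ≠ 0 := fun k hk =>
    sub_ne_zero.2 fun h => hk (hH.distinct u.1 u.2 h)
  -- The continuous extension across the pole: the `k = i` term is constant, since `(μ - u^i) / (u^i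
  -- - μ) = -1`, and the other terms are regular at `u^i`.
  set R : ℝ → ℝ := fun μ => 3 * f i * c i (u.1 i) + (μ - u.1 i) *
    ∑ k ∈ Finset.univ.erase i, ((u.1 k - μ) * f k)⁻¹ * (-3 * f k ^ 2 * c k (u.1 k))
  have hev : (fun μ => (μ - u.1 i) * ((H.metric μ u)⁻¹ * Q.tensorA H μ u).trace)
      =ᶠ[𝓝[≠] (u.1 i)] R := by
    have h1 : ∀ᶠ μ in 𝓝[≠] (u.1 i), ∀ k, k ≠ i → u.1 k - μ ≠ 0 := by
      refine Filter.Eventually.filter_mono nhdsWithin_le_nhds ?_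
      refine Filter.eventually_all.2 fun k => ?_
      by_cases hk : k = i
      · simp [hk]
      · have hc : ContinuousAt (fun μ => u.1 k - μ) (u.1 i) := by fun_prop
        filter_upwards [hc.eventually_ne (hne k hk)] with μ hμ _ using hμ
    filter_upwards [h1, self_mem_nhdsWithin] with μ hμ hμi
    have hμi' : u.1 i - μ ≠ 0 := sub_ne_zero.2 (Ne.symm hμi)
    rw [htr μ fun k => if hk : k = i then hk ▸ hμi' else hμ k hk,
      ← Finset.add_sum_erase _ _ (Finset.mem_univ i), mul_add]
    congr 1
    have := hf i
    field_simp
    ring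
  have hR : ContinuousAt R (u.1 i) := by
    refine continuousAt_const.add (ContinuousAt.mul (by fun_prop) ?_)
    refine tendsto_finsetSum _ fun k hk => ?_
    refine ContinuousAt.mul (ContinuousAt.inv₀ (by fun_prop) ?_) continuousAt_const
    exact mul_ne_zero (hne k (Finset.ne_of_mem_erase hk)) (hf k)
  have hlim : Filter.Tendsto (fun μ => (μ - u.1 i) *
      ((H.metric μ u)⁻¹ * Q.tensorA H μ u).trace) (𝓝[≠] (u.1 i))
      (𝓝 (3 * f i * c i (u.1 i))) := by
    refine Filter.Tendsto.congr' hev.symm ?_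
    have := hR.tendsto.mono_left (nhdsWithin_le_nhds (s := {u.1 i}ᶜ))
    simpa [R] using this
  rw [Pencil.centralInvariant, hlim.limUnder_eq]
  have := hf i
  change -(1 / (3 * f i)) * (3 * f i * c i (u.1 i)) = _
  field_simp

end Standard

/-! ### Polynomial degrees of the parameters and iterated Lie derivatives -/

lemma HasMaxDegree.neg {c : U → Fin n → ℝ} {l : ℕ} (h : HasMaxDegree c l) :
    HasMaxDegree (fun u i => - c u i) l := by
  obtain ⟨p, hp, hdeg⟩ := h
  refine ⟨fun i => - p i, fun u i => ?_, ?_⟩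
  · simp only [hp, Polynomial.eval_neg]
  · simpa only [Polynomial.degree_neg] using hdeg

/-- Both directions rest on `hvanish` and `hcoeff`: the `m`-th iterate is zero exactly when all
`m`-th derivatives of the parameters vanish on the projections of `U`. -/
lemma hasMaxDegree_param_iff (hU : IsOpen U) (hconn : IsConnected U) {H : HydroPencil n}
    (hH : H.IsSemisimple U) (hω : diagDerivBi (H.ω₁ : Bivector U) = 0) {c : Fin n → ℝ → ℝ}
    (hc : ∀ i, ContDiffOn ℝ ∞ (c i) ((fun u : Fin n → ℝ => u i) '' U)) (l : ℕ) :
    HasMaxDegree (U := U) (fun u i => c i (u.1 i)) l ↔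
      diagDerivBi^[l + 1] (lieDeriv (H.fieldX c) H.ω₁ : Bivector U) = 0 ∧
      diagDerivBi^[l] (lieDeriv (H.fieldX c) H.ω₁ : Bivector U) ≠ 0 := by
  have hinv : ∀ k, H.f k ∈ invariantAlg hU := fun k => H.f_mem_invariantAlg hH hω k
  have hopen : ∀ i, IsOpen ((fun u : Fin n → ℝ => u i) '' U) := fun i =>
    isOpenMap_eval i U hU
  have hsmooth : ∀ m i, ContDiffOn ℝ ∞ (deriv^[m] (c i)) ((fun u : Fin n → ℝ => u i) '' U) := by
    intro m
    induction m with
    | zero => exact hc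
    | succ m ih =>
      simp only [Function.iterate_succ_apply']
      exact contDiffOn_deriv_param ih hU
  have hvanish : ∀ m, (∀ i, ∀ u ∈ U, deriv^[m] (c i) (u i) = 0) →
      diagDerivBi^[m] (lieDeriv (H.fieldX c) H.ω₁ : Bivector U) = 0 := fun m h => by
    rw [H.iterate_diagDerivBi hU hH hω hc, H.fieldX_congr (c' := fun _ _ => 0)
      fun u hu j => h j u hu, H.fieldX_zero hU, lieDeriv_zero_left hU]
  have hcoeff : ∀ m, diagDerivBi^[m] (lieDeriv (H.fieldX c) H.ω₁ : Bivector U) = 0 →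
      ∀ i, ∀ u ∈ U, deriv^[m] (c i) (u i) = 0 := fun m h i u hu => by
    rw [H.iterate_diagDerivBi hU hH hω hc] at h
    have h3 := H.lieDeriv_fieldX_coeff_three hH hinv (hsmooth m) i (constJet ⟨u, hu⟩)
    rw [h] at h3
    have hf := hH.f_ne_zero hU i (constJet ⟨u, hu⟩)
    refine (mul_eq_zero.1 h3.symm).resolve_left (mul_ne_zero (by norm_num) (pow_ne_zero 2 hf))
  constructor
  · rintro ⟨p, hp, hdeg⟩
    have hpI : ∀ i, ∀ x ∈ (fun u : Fin n → ℝ => u i) '' U, c i x = (p i).eval x := by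
      rintro i _ ⟨u, hu, rfl⟩
      exact hp ⟨u, hu⟩ i
    refine ⟨hvanish _ fun i u hu => ?_, fun h => ?_⟩
    · rw [iterate_deriv_eq_eval (hopen i) (hpI i) _ _ ⟨u, hu, rfl⟩,
        Polynomial.iterate_derivative_eq_zero_of_degree_lt, Polynomial.eval_zero]
      have h1 : (p i).degree ≤ l := 
        hdeg ▸ Finset.le_sup (f := fun i => (p i).degree) (Finset.mem_univ i)
      exact h1.trans_lt (by exact_mod_cast Nat.lt_succ_self l)
    -- For `n = 0` the supremum is `⊥`, which is not a natural number; otherwise some index attains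
    -- the degree `l`.
    · have hne : (Finset.univ : Finset (Fin n)).Nonempty := by
        by_contra hemp
        rw [Finset.not_nonempty_iff_eq_empty] at hemp
        rw [hemp, Finset.sup_empty] at hdeg
        exact WithBot.bot_ne_coe hdeg
      obtain ⟨i, -, hi⟩ := Finset.exists_mem_eq_sup _ hne fun i => (p i).degree
      obtain ⟨u, hu⟩ := hconn.nonempty
      refine eval_iterate_derivative_ne_zero (hi.symm.trans hdeg) (u i) ?_
      rw [← iterate_deriv_eq_eval (hopen i) (hpI i) _ _ ⟨u, hu, rfl⟩]
      exact hcoeff l h i u hu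
  · rintro ⟨h1, h2⟩
    have hpoly : ∀ i, ∃ p : Polynomial ℝ, p.degree < (l + 1 : ℕ) ∧
        ∀ x ∈ (fun u : Fin n → ℝ => u i) '' U, c i x = p.eval x := fun i => by
      refine exists_polynomial_of_iterate_deriv_eq_zero (hopen i)
        (hconn.isPreconnected.image _ (continuous_apply i).continuousOn) _ (hc i) ?_
      rintro _ ⟨u, hu, rfl⟩
      exact hcoeff _ h1 i u hu
    choose p hpdeg hp using hpoly
    refine ⟨p, fun u i => hp i _ ⟨u.1, u.2, rfl⟩, le_antisymm ?_ ?_⟩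
    · refine Finset.sup_le fun i _ => Order.lt_succ_iff.1 ((hpdeg i).trans_le ?_)
      rfl
    -- If all degrees were below `l`, the `l`-th derivatives would already vanish, contrary to `h2`.
    · by_contra hlt
      refine h2 (hvanish l fun i u hu => ?_)
      rw [iterate_deriv_eq_eval (hopen i) (hp i) _ _ ⟨u, hu, rfl⟩,
        Polynomial.iterate_derivative_eq_zero_of_degree_lt, Polynomial.eval_zero]
      exact (Finset.le_sup (f := fun i => (p i).degree) (Finset.mem_univ i)).trans_lt
        (not_le.1 hlt)

end LoopSpace

end

theorem mainTheorem6 {n : ℕ} (U : Set (Fin n → ℝ)) (hU : IsOpen U) (hconn : IsConnected U)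
    (H : LoopSpace.HydroPencil n) (hH : H.IsSemisimple U)
    (e : (Fin n → ℝ) → Fin n → ℝ) (he : H.IsExactFor U e)
    (Q : LoopSpace.Pencil U) (hQ : Q.IsBiHamiltonian) (hred : Q.IsReduced H)
    (c : Fin n → ℝ → ℝ) (hstd : Q.IsStandardForm H c) (l : ℕ) :
    (LoopSpace.HasMaxDegree (Q.centralInvariant H) l ↔
      (LoopSpace.lieDeriv (LoopSpace.liftVec e))^[l + 1] (Q.P₂ 2) = 0 ∧
      (LoopSpace.lieDeriv (LoopSpace.liftVec e))^[l] (Q.P₂ 2) ≠ 0) ∧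
    (LoopSpace.HasMaxDegree (U := U) (fun u i => c i (u.1 i)) l ↔
      (LoopSpace.lieDeriv (LoopSpace.liftVec e))^[l + 1] (Q.P₂ 2) = 0 ∧
      (LoopSpace.lieDeriv (LoopSpace.liftVec e))^[l] (Q.P₂ 2) ≠ 0) := by
  have hlie : LoopSpace.lieDeriv (U := U) (LoopSpace.liftVec e) = LoopSpace.diagDerivBi :=
    funext fun P => LoopSpace.lieDeriv_liftVec_of_eq_one hU (he.eq_one hU hH) P
  have hω : LoopSpace.diagDerivBi (H.ω₁ : LoopSpace.Bivector U) = 0 := by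
    rw [← hlie]
    exact he.lie_ω₁
  have hci : Q.centralInvariant H = fun u i => - c i (u.1 i) :=
    funext fun u => funext fun i => Q.centralInvariant_eq hU hH hω hred hstd u i
  have hneg : LoopSpace.HasMaxDegree (Q.centralInvariant H) l ↔
      LoopSpace.HasMaxDegree (U := U) (fun u i => c i (u.1 i)) l := by
    rw [hci]
    -- Negation is an involution that preserves degrees.
    exact ⟨fun h => by simpa using h.neg, fun h => h.neg⟩
  have hparam := LoopSpace.hasMaxDegree_param_iff hU hconn hH hω hstd.smooth l
  rw [hneg, hlie, hstd.eq_lie]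
  exact ⟨hparam, hparam⟩
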